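/- Let $n,k\ge 2$ and let $\Delta_{nk}=\{\lambda\in\mathbb R^{nk}:\lambda_i\ge 0,\ \sum_i\lambda_i=1\}$. For $\lambda\in\mathbb R^{nk}$ let $\lambda^\downarrow_1\ge\dots\ge\lambda^\downarrow_{nk}$ be its entries in decreasing order. Let $D_{n,k}$ be the set of density matrices (positive semidefinite matrices of trace $1$) in $M_n(\mathbb C)\otimes M_k(\mathbb C)$. For a set $A\subseteq\Delta_{nk}$ put $\Lambda(A)=\sup_{\lambda\in A}\lambda^\downarrow_1$; a unitarily invariant set of density matrices is identified with the set of its vectors of eigenvalues (counted with multiplicity, in any order). Consider the following sets. - $\mathrm{ARED}$: all $\rho\in D_{n,k}$ with $(\mathrm{id}_n\otimes R)(U\rho U^*)\ge 0$ for every unitary $U$ of size $nk$, where $R(X)=I_k\operatorname{Tr}[X]-X$ on $M_k(\mathbb C)$. - $\mathrm{APPT}$: all $\rho\in D_{n,k}$ with $(\mathrm{id}_n\otimes\Theta)(U\rho U^*)\ge 0$ for every unitary $U$ of size $nk$, where $\Theta(X)=X^T$ on $M_k(\mathbb C)$. - $\mathrm{ASEP}$: all $\rho\in D_{n,k}$ such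 that, for every unitary $U$ of size $nk$, $U\rho U^*$ is separable, i.e. a convex combination of products $\sigma\otimes\tau$ of density matrices $\sigma\in M_n(\mathbb C)$, $\tau\in M_k(\mathbb C)$. - $\mathrm{SEPBALL}$: all $\rho\in D_{n,k}$ with $\operatorname{Tr}[\rho^2]\le\frac1{nk-1}$. - $\mathrm{GER}$: all $\lambda\in\Delta_{nk}$ with $\sum_{i=1}^{r-1}\lambda^\downarrow_i\le 2\lambda^\downarrow_{nk}+\sum_{i=1}^{r-1}\lambda^\downarrow_{nk-i}$, where $r=\min(n,k)$. - $\mathrm{LS}_p$ ($1\le p\le nk$): all $\lambda\in\Delta_{nk}$ with $\lambda^\downarrow_1\le\lambda^\downarrow_{nk-p+1}+\dots+\lambda^\downarrow_{nk}$. Then $$\Lambda(\mathrm{ARED})=\begin{cases}\dfrac{k+1}{k(n+1)} & \text{if } k\le n,\\[1ex] \dfrac1n & \text{if } k\ge n,\end{cases}$$ $$\Lambda(\mathrm{LS}_p)=\frac{p}{nk+p-1}\quad (1\le p\le nk-1),\qquad \Lambda(\mathrm{LS}_{nk})=1,$$ $$\Lambda(\mathrm{ASEP})=\Lambda(\mathrm{APPT})=\Lambda(\mathrm{GER})=\frac{3}{nk+2},\qquad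 \Lambda(\mathrm{SEPBALL})=\frac{2}{nk}.$$ -/

import Mathlib

open scoped Kronecker ComplexOrder

namespace AbsSpec

noncomputable section

/-! ### States, positive maps, bipartite sets -/

/-- Density matrices: positive semidefinite with unit trace. -/
def density (ι : Type*) [Fintype ι] : Set (Matrix ι ι ℂ) :=
  {ρ | ρ.PosSemidef ∧ ρ.trace = 1}

/-- Bipartite matrices `M_n(ℂ) ⊗ M_k(ℂ)`; the product basis is indexed by pairs, and the tensor
product of `A` and `B` is `A ⊗ₖ B`. -/
abbrev BiMat (n k : ℕ) : Type := Matrix (Fin n × Fin k) (Fin n × Fin k) ℂ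

/-- The reduction map `R(X) = Tr[X] · I - X`. -/
def reductionMap {k : ℕ} (X : Matrix (Fin k) (Fin k) ℂ) : Matrix (Fin k) (Fin k) ℂ :=
  X.trace • 1 - X

/-- `(id_n ⊗ P)(X)`: the map `P` is applied to each of the `n × n` blocks (of size `k × k`)
of `X`. -/
def idTensor {n k : ℕ} (P : Matrix (Fin k) (Fin k) ℂ → Matrix (Fin k) (Fin k) ℂ)
    (X : BiMat n k) : BiMat n k :=
  Matrix.of fun x y => P (Matrix.of fun a b => X (x.1, a) (y.1, b)) x.2 y.2

/-- States that stay positive under the reduction map on the second factor. -/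
def RED (n k : ℕ) : Set (BiMat n k) :=
  {ρ | ρ ∈ density (Fin n × Fin k) ∧ (idTensor reductionMap ρ).PosSemidef}

/-- States with positive partial transpose. -/
def PPT (n k : ℕ) : Set (BiMat n k) :=
  {ρ | ρ ∈ density (Fin n × Fin k) ∧ (idTensor Matrix.transpose ρ).PosSemidef}

/-- Separable states: convex combinations of product states. -/
def SEP (n k : ℕ) : Set (BiMat n k) :=
  {ρ | ρ ∈ density (Fin n × Fin k) ∧
    ρ ∈ convexHull ℝ {τ : BiMat n k |
      ∃ A ∈ density (Fin n), ∃ B ∈ density (Fin k), τ = A ⊗ₖ B}}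

/-- States all of whose global unitary conjugates lie in `C`. -/
def absolutely {n k : ℕ} (C : Set (BiMat n k)) : Set (BiMat n k) :=
  {ρ | ρ ∈ density (Fin n × Fin k) ∧
    ∀ U ∈ Matrix.unitaryGroup (Fin n × Fin k) ℂ, U * ρ * star U ∈ C}

/-- Absolutely RED states. -/
def ARED (n k : ℕ) : Set (BiMat n k) := absolutely (RED n k)

/-- Absolutely PPT states. -/
def APPT (n k : ℕ) : Set (BiMat n k) := absolutely (PPT n k)

/-- Absolutely separable states. -/
def ASEP (n k : ℕ) : Set (BiMat n k) := absolutely (SEP n k)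

/-- States with `Tr[ρ²] ≤ 1 / (nk - 1)`. -/
def SEPBALL (n k : ℕ) : Set (BiMat n k) :=
  {ρ | ρ ∈ density (Fin n × Fin k) ∧ (ρ ^ 2).trace.re ≤ 1 / ((n : ℝ) * k - 1)}

/-! ### Spectra -/

/-- The probability simplex `Δ_d`. -/
abbrev simplex (d : ℕ) : Set (Fin d → ℝ) := stdSimplex ℝ (Fin d)

/-- `desc v j` is the `j`-th largest entry of `v`, for `j = 1, …, d` (with multiplicity);
the value is `0` for other `j`. -/
def desc {d : ℕ} (v : Fin d → ℝ) (j : ℕ) : ℝ :=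
  if h : 1 ≤ j ∧ j ≤ d then
    v (Tuple.sort (fun i => -v i) ⟨j - 1, by omega⟩)
  else 0

/-- The set of eigenvalue vectors (in any order, with multiplicity) of the elements of a set of
bipartite states. -/
def spectra {n k : ℕ} (S : Set (BiMat n k)) : Set (Fin (n * k) → ℝ) :=
  {v | v ∈ simplex (n * k) ∧ ∃ ρ ∈ S, ∃ h : ρ.IsHermitian,
    ∃ e : Fin (n * k) ≃ Fin n × Fin k, v = h.eigenvalues ∘ e}

/-- Probability vectors whose largest entry is at most the sum of the `p` smallest entries
`v_{d-p+1}^↓, …, v_d^↓`. -/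
def LS (d p : ℕ) : Set (Fin d → ℝ) :=
  {v | v ∈ simplex d ∧ desc v 1 ≤ ∑ j ∈ Finset.Icc (d - p + 1) d, desc v j}

/-- Probability vectors `v` with
`∑_{i=1}^{r-1} v_i^↓ ≤ 2 v_{nk}^↓ + ∑_{i=1}^{r-1} v_{nk-i}^↓`, where `r = min(n,k)`. -/
def GER (n k : ℕ) : Set (Fin (n * k) → ℝ) :=
  {v | v ∈ simplex (n * k) ∧
    ∑ i ∈ Finset.Icc 1 (min n k - 1), desc v i ≤
      2 * desc v (n * k) + ∑ i ∈ Finset.Icc 1 (min n k - 1), desc v (n * k - i)}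

/-- `Λ(A) = sup_{v ∈ A} v_1^↓`, for a set `A` of probability vectors. -/
def Lambda {d : ℕ} (A : Set (Fin d → ℝ)) : ℝ := sSup ((fun v => desc v 1) '' A)

/-- On sets of probability vectors, the supremum that defines `Λ` is over a bounded set. -/
theorem bddAbove_desc_one {d : ℕ} {A : Set (Fin d → ℝ)} (hA : A ⊆ simplex d) :
    BddAbove ((fun v => desc v 1) '' A) := by
  refine ⟨1, ?_⟩
  rintro _ ⟨v, hv, rfl⟩
  have hs := hA hv
  simp only [desc]
  split_ifs with h
  · exact (Finset.single_le_sum (fun i _ => hs.1 i) (Finset.mem_univ _)).trans hs.2.le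
  · exact zero_le_one

end

end AbsSpec

namespace AbsSpec

open Matrix

/-! ### Decreasing rearrangements -/

/-! Every supremum is attained at a spectrum `(a, b, …, b)`, so each value needs a bound on the
largest entry and one such example.

Upper bounds. For `LS` and `GER` they follow from the ordering of the entries, for `SEPBALL` from
Cauchy–Schwarz on the remaining eigenvalues. For `APPT` and `ARED`, a suitable test vector turns
positivity into `c ⟨ψ, τ ψ⟩ ≤ Tr (Q τ)` for every conjugate `τ` of `ρ`, with `Q` a coordinate
projection fixing `ψ`. A unitary can place any chosen eigenvalue at `ψ` and the others in any order;
averaging over these orders leaves an inequality in that eigenvalue alone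
(`eigenvalues_le_of_forall_unitary`).

Examples. A conjugate of a spiked diagonal matrix is `b • 1 + (a - b) • u u*` with `u` a unit
vector. For `ARED` one needs the least eigenvalue of the reduction map on `u u*` to be at least `-(1
- 1/r)`, `r = min n k`; this follows from `|Tr X|² ≤ r ‖X‖²` (Frobenius norm) for `X` factoring
through dimension `r` (`posSemidef_idTensor_reductionMap`). For `ASEP` one needs `1 + 2 u u*` to be
separable (`one_add_two_smul_mem_sepCone`): averaging product vectors with random opposite phases in
the Schmidt basis gives `u u*` plus a diagonal error, which the identity absorbs. As `ASEP ⊆ APPT`,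
this example and the `APPT` bound settle both sets. -/

theorem desc_eq {d : ℕ} (v : Fin d → ℝ) {j : ℕ} (h1 : 1 ≤ j) (h2 : j ≤ d) :
    desc v j = v (Tuple.sort (fun i => -v i) ⟨j - 1, by omega⟩) := by
  simp [desc, h1, h2]

theorem desc_anti {d : ℕ} (v : Fin d → ℝ) {i j : ℕ} (h1 : 1 ≤ i) (hij : i ≤ j) (h2 : j ≤ d) :
    desc v j ≤ desc v i := by
  rw [desc_eq v h1 (hij.trans h2), desc_eq v (h1.trans hij) h2]
  have h := Tuple.monotone_sort (fun i => -v i)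
    (show (⟨i - 1, by omega⟩ : Fin d) ≤ ⟨j - 1, by omega⟩ by
      simp only [Fin.mk_le_mk]; omega)
  simpa using h

theorem le_desc_one {d : ℕ} (v : Fin d → ℝ) (i : Fin d) : v i ≤ desc v 1 := by
  have hd : 1 ≤ d := by have := i.2; omega
  rw [desc_eq v le_rfl hd]
  have h := Tuple.monotone_sort (fun i => -v i)
    (show (⟨1 - 1, by omega⟩ : Fin d) ≤ (Tuple.sort (fun i => -v i)).symm i by
      simp [Fin.le_def])
  simpa using h

theorem exists_desc_one_eq {d : ℕ} (hd : 1 ≤ d) (v : Fin d → ℝ) : ∃ i, desc v 1 = v i :=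
  ⟨_, desc_eq v le_rfl hd⟩

theorem sum_desc {d : ℕ} (v : Fin d → ℝ) : ∑ j ∈ Finset.Icc 1 d, desc v j = ∑ i, v i := by
  rw [← Equiv.sum_comp (Tuple.sort (fun i => -v i)) v]
  symm
  refine Finset.sum_bij (fun i _ => i.1 + 1) ?_ ?_ ?_ ?_
  · intro i _
    have := i.2
    simp only [Finset.mem_Icc]; omega
  · intro i _ j _ h
    ext; omega
  · intro j hj
    rw [Finset.mem_Icc] at hj
    exact ⟨⟨j - 1, by omega⟩, Finset.mem_univ _, by simp only; omega⟩
  · intro i _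
    have := i.2
    rw [desc_eq v (by omega) (by omega)]
    simp

/-- The vector `(a, b, …, b)`. -/
def spike {ι : Type*} [DecidableEq ι] (t : ι) (a b : ℝ) : ι → ℝ := fun i => if i = t then a else b

theorem sum_spike {ι : Type*} [Fintype ι] [DecidableEq ι] (t : ι) (a b : ℝ) :
    ∑ i, spike t a b i = a + ((Fintype.card ι : ℝ) - 1) * b := by
  have h : ∀ i, spike t a b i = b + if i = t then a - b else 0 := by
    intro i; simp only [spike]; split_ifs <;> ring
  simp only [h, Finset.sum_add_distrib, Finset.sum_ite_eq', Finset.mem_univ, if_true]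
  simp
  ring

theorem desc_one_spike {d : ℕ} (t : Fin d) {a b : ℝ} (h : b ≤ a) : desc (spike t a b) 1 = a := by
  apply le_antisymm
  · obtain ⟨i, hi⟩ := exists_desc_one_eq (by have := t.2; omega) (spike t a b)
    rw [hi, spike]; split_ifs <;> linarith
  · simpa [spike] using le_desc_one (spike t a b) t

/-- If `b < a`, the sorting permutation must send position one to `t`; injectivity keeps `t` out of
all later positions. -/
theorem desc_spike {d : ℕ} (t : Fin d) {a b : ℝ} (h : b ≤ a) {j : ℕ} (h2 : 2 ≤ j) (hj : j ≤ d) :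
    desc (spike t a b) j = b := by
  rcases h.eq_or_lt with rfl | hlt
  · rw [desc_eq _ (by omega) hj]; simp [spike]
  have h1 := desc_one_spike t h
  rw [desc_eq _ le_rfl (by omega)] at h1
  rw [desc_eq _ (by omega) hj]
  generalize Tuple.sort (fun i => -spike t a b i) = σ at h1 ⊢
  unfold spike at h1 ⊢
  split_ifs at h1 with h3
  · rw [if_neg]
    intro h4
    have h5 := σ.injective (h3.trans h4.symm)
    rw [Fin.mk.injEq] at h5
    omega
  · exact absurd h1 hlt.ne

theorem spike_mem_simplex {d : ℕ} (t : Fin d) {a b : ℝ} (ha : 0 ≤ a) (hb : 0 ≤ b)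
    (h : a + ((d : ℝ) - 1) * b = 1) : spike t a b ∈ simplex d := by
  refine ⟨fun i => ?_, ?_⟩
  · rw [spike]; split_ifs <;> assumption
  · rw [sum_spike]; simpa using h

theorem Lambda_eq {d : ℕ} {A : Set (Fin d → ℝ)} {c : ℝ} (hle : ∀ v ∈ A, desc v 1 ≤ c)
    (hex : ∃ v ∈ A, desc v 1 = c) : Lambda A = c := by
  apply IsGreatest.csSup_eq
  refine ⟨?_, ?_⟩
  · obtain ⟨v, hv, h⟩ := hex
    exact ⟨v, hv, h⟩
  · rintro _ ⟨v, hv, rfl⟩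
    exact hle v hv

/-! ### The sets `LS` and `GER` -/

/-- With `m` the largest of the `p` smallest entries and `S` their sum, `m ≥ S / p`, so the entries
strictly between the first and these `p` sum to at least `(d - 1 - p) S / p`. Unit total and `desc v
1 ≤ S` then give the bound. Since `p < d`, position one is not among the `p` smallest. -/
theorem desc_one_le_of_mem_LS {d p : ℕ} (hp : 1 ≤ p) (hpd : p < d) {v : Fin d → ℝ}
    (hv : v ∈ LS d p) : desc v 1 ≤ p / ((d : ℝ) + p - 1) := by
  obtain ⟨hs, hle⟩ := hv
  set S := ∑ j ∈ Finset.Icc (d - p + 1) d, desc v j with hS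
  set m := desc v (d - p + 1) with hm
  have hSm : S ≤ p * m := by
    have h := Finset.sum_le_card_nsmul (Finset.Icc (d - p + 1) d) (desc v) m (fun j hj => by
      rw [Finset.mem_Icc] at hj
      exact desc_anti v (by omega) hj.1 hj.2)
    rw [Nat.card_Icc, show d + 1 - (d - p + 1) = p by omega, nsmul_eq_mul] at h
    exact h
  have hR : ((d : ℝ) - 1 - p) * m ≤ ∑ j ∈ Finset.Icc 2 (d - p), desc v j := by
    have h := Finset.card_nsmul_le_sum (Finset.Icc 2 (d - p)) (desc v) m (fun j hj => by
      rw [Finset.mem_Icc] at hj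
      exact desc_anti v (by omega) (by omega) (by omega))
    rw [Nat.card_Icc, nsmul_eq_mul] at h
    have e : ((d - p + 1 - 2 : ℕ) : ℝ) = (d : ℝ) - 1 - p := by
      rw [show d - p + 1 - 2 = d - (1 + p) by omega, Nat.cast_sub (by omega)]
      push_cast; ring
    rwa [e] at h
  have htot : desc v 1 + ∑ j ∈ Finset.Icc 2 (d - p), desc v j + S = 1 := by
    rw [← hs.2, ← sum_desc]
    have e1 : Finset.Icc 1 d = insert 1 (Finset.Icc 2 (d - p)) ∪ Finset.Icc (d - p + 1) d := by
      ext j; simp only [Finset.mem_union, Finset.mem_insert, Finset.mem_Icc]; omega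
    rw [e1, Finset.sum_union, Finset.sum_insert]
    · simp
    · rw [Finset.disjoint_left]
      intro j; simp only [Finset.mem_insert, Finset.mem_Icc]; omega
  have hp' : (1 : ℝ) ≤ p := by exact_mod_cast hp
  have hd' : (p : ℝ) + 1 ≤ d := by exact_mod_cast hpd
  rw [le_div_iff₀ (by linarith)]
  nlinarith [mul_le_mul_of_nonneg_left hSm (show (0 : ℝ) ≤ (d : ℝ) - 1 - p by linarith),
    mul_le_mul_of_nonneg_left hR (show (0 : ℝ) ≤ p by linarith),
    mul_le_mul_of_nonneg_left hle (show (0 : ℝ) ≤ (d : ℝ) - 1 by linarith)]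

theorem Lambda_LS {d p : ℕ} (hp : 1 ≤ p) (hpd : p < d) :
    Lambda (LS d p) = p / ((d : ℝ) + p - 1) := by
  refine Lambda_eq (fun v hv => desc_one_le_of_mem_LS hp hpd hv) ?_
  have hp' : (1 : ℝ) ≤ p := by exact_mod_cast hp
  have hd' : (p : ℝ) + 1 ≤ d := by exact_mod_cast hpd
  have hD : (0 : ℝ) < (d : ℝ) + p - 1 := by linarith
  have hba : 1 / ((d : ℝ) + p - 1) ≤ p / ((d : ℝ) + p - 1) := by gcongr
  refine ⟨spike ⟨0, by omega⟩ (p / ((d : ℝ) + p - 1)) (1 / ((d : ℝ) + p - 1)),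
    ⟨spike_mem_simplex _ (by positivity) (by positivity) (by field_simp; ring), ?_⟩,
    desc_one_spike _ hba⟩
  rw [desc_one_spike _ hba]
  rw [Finset.sum_congr rfl (g := fun _ => 1 / ((d : ℝ) + p - 1)) (fun j hj => by
    rw [Finset.mem_Icc] at hj
    exact desc_spike _ hba (by omega) hj.2)]
  rw [Finset.sum_const, Nat.card_Icc, show d + 1 - (d - p + 1) = p by omega, nsmul_eq_mul]
  exact le_of_eq (by ring)

theorem desc_one_le_one {d : ℕ} (hd : 1 ≤ d) {v : Fin d → ℝ} (hv : v ∈ simplex d) :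
    desc v 1 ≤ 1 := by
  obtain ⟨i, hi⟩ := exists_desc_one_eq hd v
  rw [hi, ← hv.2]
  exact Finset.single_le_sum (fun i _ => hv.1 i) (Finset.mem_univ i)

theorem Lambda_LS_self {d : ℕ} (hd : 1 ≤ d) : Lambda (LS d d) = 1 := by
  refine Lambda_eq (fun v hv => desc_one_le_one hd hv.1) ?_
  have hs : spike (⟨0, by omega⟩ : Fin d) 1 0 ∈ simplex d :=
    spike_mem_simplex _ zero_le_one le_rfl (by simp)
  refine ⟨spike ⟨0, by omega⟩ 1 0, ⟨hs, ?_⟩, desc_one_spike _ zero_le_one⟩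
  rw [show d - d + 1 = 1 by omega, sum_desc, hs.2]
  exact desc_one_le_one hd hs

/-- As `2 r ≤ n k`, the terms with `i ≥ 2` on the left dominate those on the right and cancel,
leaving `v_1 ≤ 2 v_d + v_{d-1}`; one copy of `v_d` is then raised to `v_{d-2}`. -/
theorem GER_subset_LS {n k : ℕ} (hn : 2 ≤ n) (hk : 2 ≤ k) : GER n k ⊆ LS (n * k) 3 := by
  rintro v ⟨hs, hle⟩
  refine ⟨hs, ?_⟩
  have hr : 2 ≤ min n k := le_min hn hk
  have hrd : min n k * min n k ≤ n * k := Nat.mul_le_mul (min_le_left _ _) (min_le_right _ _)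
  have h2r : 2 * min n k ≤ n * k := (Nat.mul_le_mul_right _ hr).trans hrd
  generalize n * k = d at *
  generalize min n k = r at *
  have e1 : Finset.Icc 1 (r - 1) = insert 1 (Finset.Icc 2 (r - 1)) := by
    ext j; simp only [Finset.mem_insert, Finset.mem_Icc]; omega
  have e2 : Finset.Icc (d - 3 + 1) d = {d - 2, d - 1, d} := by
    ext j; simp only [Finset.mem_insert, Finset.mem_singleton, Finset.mem_Icc]; omega
  rw [e1, Finset.sum_insert (by simp), Finset.sum_insert (by simp)] at hle
  rw [e2, Finset.sum_insert, Finset.sum_insert, Finset.sum_singleton]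
  · have h1 : ∑ i ∈ Finset.Icc 2 (r - 1), desc v (d - i) ≤
        ∑ i ∈ Finset.Icc 2 (r - 1), desc v i := by
      refine Finset.sum_le_sum fun i hi => ?_
      rw [Finset.mem_Icc] at hi
      exact desc_anti v (by omega) (by omega) (by omega)
    have h2 : desc v d ≤ desc v (d - 2) := desc_anti v (by omega) (by omega) le_rfl
    linarith
  · simp only [Finset.mem_singleton]; omega
  · simp only [Finset.mem_insert, Finset.mem_singleton]; omega

theorem Lambda_GER {n k : ℕ} (hn : 2 ≤ n) (hk : 2 ≤ k) :
    Lambda (GER n k) = 3 / ((n : ℝ) * k + 2) := by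
  have hd : 4 ≤ n * k := Nat.mul_le_mul hn hk
  have hd' : (4 : ℝ) ≤ (n : ℝ) * k := by exact_mod_cast hd
  refine Lambda_eq (fun v hv => ?_) ?_
  · have h := desc_one_le_of_mem_LS (by norm_num) (by omega) (GER_subset_LS hn hk hv)
    refine h.trans (le_of_eq ?_)
    push_cast
    congr 1; ring
  · have hba : 1 / ((n : ℝ) * k + 2) ≤ 3 / ((n : ℝ) * k + 2) := by gcongr; norm_num
    refine ⟨spike ⟨0, by omega⟩ (3 / ((n : ℝ) * k + 2)) (1 / ((n : ℝ) * k + 2)),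
      ⟨spike_mem_simplex _ (by positivity) (by positivity) (by push_cast; field_simp; ring), ?_⟩,
      desc_one_spike _ hba⟩
    have hr : 2 ≤ min n k := le_min hn hk
    have hrd : min n k * min n k ≤ n * k := Nat.mul_le_mul (min_le_left _ _) (min_le_right _ _)
    have h2r : 2 * min n k ≤ n * k := (Nat.mul_le_mul_right _ hr).trans hrd
    have h1 := desc_one_spike (⟨0, by omega⟩ : Fin (n * k)) hba
    have h2 := fun {j : ℕ} => desc_spike (j := j) (⟨0, by omega⟩ : Fin (n * k)) hba
    generalize spike (⟨0, by omega⟩ : Fin (n * k)) (3 / ((n : ℝ) * k + 2))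
      (1 / ((n : ℝ) * k + 2)) = v at *
    generalize min n k = r at *
    have e1 : Finset.Icc 1 (r - 1) = insert 1 (Finset.Icc 2 (r - 1)) := by
      ext j; simp only [Finset.mem_insert, Finset.mem_Icc]; omega
    have e2 : ∑ i ∈ Finset.Icc 2 (r - 1), desc v i =
        ∑ i ∈ Finset.Icc 2 (r - 1), desc v (n * k - i) := by
      refine Finset.sum_congr rfl fun i hi => ?_
      rw [Finset.mem_Icc] at hi
      rw [h2 (by omega) (by omega), h2 (by omega) (by omega)]
    rw [e1, Finset.sum_insert (by simp), Finset.sum_insert (by simp), h1,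
      h2 (by omega) le_rfl, h2 (by omega) (by omega), e2]
    exact le_of_eq (by ring)

/-! ### Largest eigenvalues over unitarily invariant sets -/

theorem range_eigenvalues_diagonal {ι : Type*} [Fintype ι] [DecidableEq ι] (f : ι → ℝ)
    (h : (diagonal fun i => (f i : ℂ)).IsHermitian) :
    Set.range h.eigenvalues = Set.range f := by
  have h1 := h.roots_charpoly_eq_eigenvalues
  have h0 : (∏ i, (Polynomial.X - Polynomial.C (f i : ℂ))) =
      (Multiset.map (fun a => Polynomial.X - Polynomial.C a)
        (Finset.univ.val.map fun i => (f i : ℂ))).prod := by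
    rw [Multiset.map_map]; rfl
  rw [charpoly_diagonal, h0, Polynomial.roots_multiset_prod_X_sub_C] at h1
  ext x
  have h2 : ((x : ℂ) ∈ Finset.univ.val.map fun i => (f i : ℂ)) ↔
      ((x : ℂ) ∈ Finset.univ.val.map (RCLike.ofReal ∘ h.eigenvalues : ι → ℂ)) := by
    rw [← h1]
  simpa using h2.symm

/-- Reduces each matrix set to an eigenvalue bound and membership of a single diagonal matrix. -/
theorem Lambda_spectra_eq {n k : ℕ} {S : Set (BiMat n k)} {t : Fin n × Fin k} {a b : ℝ}
    (hS : S ⊆ density (Fin n × Fin k))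
    (hle : ∀ ρ ∈ S, ∀ h : ρ.IsHermitian, ∀ i, h.eigenvalues i ≤ a)
    (hmem : (diagonal fun i => (spike t a b i : ℂ)) ∈ S) : Lambda (spectra S) = a := by
  have hd : 1 ≤ n * k := Nat.mul_pos (by have := t.1.2; omega) (by have := t.2.2; omega)
  refine Lambda_eq ?_ ?_
  · rintro v ⟨-, ρ, hρ, h, e, rfl⟩
    obtain ⟨i, hi⟩ := exists_desc_one_eq hd (h.eigenvalues ∘ e)
    rw [hi]
    exact hle ρ hρ h _
  · have hP := (hS hmem).1
    have h := hP.isHermitian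
    have htr := (hS hmem).2
    rw [h.trace_eq_sum_eigenvalues] at htr
    obtain ⟨e⟩ : Nonempty (Fin (n * k) ≃ Fin n × Fin k) := ⟨finProdFinEquiv.symm⟩
    refine ⟨h.eigenvalues ∘ e, ⟨⟨fun i => hP.eigenvalues_nonneg _, ?_⟩, _, hmem, h, e, rfl⟩, ?_⟩
    · rw [← Equiv.sum_comp e] at htr
      simpa using congrArg Complex.re htr
    · apply le_antisymm
      · obtain ⟨i, hi⟩ := exists_desc_one_eq hd (h.eigenvalues ∘ e)
        rw [hi]
        exact hle _ hmem h _
      · have h2 : a ∈ Set.range (spike t a b) := ⟨t, by simp [spike]⟩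
        rw [← range_eigenvalues_diagonal (spike t a b) h] at h2
        obtain ⟨i, hi⟩ := h2
        have h3 := le_desc_one (h.eigenvalues ∘ e) (e.symm i)
        simpa [hi] using h3

/-- Permuting the columns of an eigenvector matrix permutes the eigenvalues, so a conjugate of `ρ`
can have any orthonormal eigenbasis `W` with the eigenvalues in any order. -/
theorem exists_unitary_conj_eq {ι : Type*} [Fintype ι] [DecidableEq ι] {ρ : Matrix ι ι ℂ}
    (h : ρ.IsHermitian) {W : Matrix ι ι ℂ} (hW : W ∈ unitaryGroup ι ℂ) (σ : Equiv.Perm ι) :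
    ∃ U ∈ unitaryGroup ι ℂ,
      U * ρ * star U = W * diagonal (fun i => (h.eigenvalues (σ i) : ℂ)) * star W := by
  set V : Matrix ι ι ℂ := h.eigenvectorUnitary.1 with hV
  have hVu : V ∈ unitaryGroup ι ℂ := h.eigenvectorUnitary.2
  have hρ : ρ = V * diagonal (fun i => (h.eigenvalues i : ℂ)) * star V := by
    have := h.spectral_theorem
    rw [Unitary.conjStarAlgAut_apply] at this
    exact this
  have hσu : (V.submatrix id σ) ∈ unitaryGroup ι ℂ := by
    rw [mem_unitaryGroup_iff', star_eq_conjTranspose, conjTranspose_submatrix,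
      ← submatrix_mul _ _ _ _ _ Function.bijective_id, ← star_eq_conjTranspose,
      mem_unitaryGroup_iff'.1 hVu, submatrix_one_equiv]
  have hρσ : ρ = V.submatrix id σ * diagonal (fun i => (h.eigenvalues (σ i) : ℂ)) *
      star (V.submatrix id σ) := by
    have hd : diagonal (fun i => (h.eigenvalues (σ i) : ℂ)) =
        (diagonal (fun i => (h.eigenvalues i : ℂ))).submatrix σ σ := by
      rw [submatrix_diagonal_equiv]; rfl
    rw [hd, star_eq_conjTranspose, conjTranspose_submatrix, submatrix_mul_equiv,
      submatrix_mul_equiv, ← star_eq_conjTranspose, ← hρ]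
    rfl
  refine ⟨W * star (V.submatrix id σ), mul_mem hW (Unitary.star_mem hσu), ?_⟩
  generalize V.submatrix id σ = X at *
  have hX := mem_unitaryGroup_iff'.1 hσu
  conv_lhs => rw [hρσ]
  rw [star_mul, star_star]
  calc W * star X * (X * diagonal (fun i => (h.eigenvalues (σ i) : ℂ)) * star X) * (X * star W)
      = W * (star X * X) * diagonal (fun i => (h.eigenvalues (σ i) : ℂ)) *
        (star X * X) * star W := by simp only [mul_assoc]
    _ = _ := by rw [hX]; simp

/-- A unitary that maps a standard basis vector to a given real unit vector `ψ` and respects a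
coordinate subspace that contains both. -/
theorem exists_unitary_col_eq {ι : Type*} [Fintype ι] [DecidableEq ι] {ψ : ι → ℝ}
    (hψ : ∑ i, ψ i ^ 2 = 1) {Q : Finset ι} (hQ : ∀ i ∉ Q, ψ i = 0) {t : ι} (ht : t ∈ Q) :
    ∃ W ∈ unitaryGroup ι ℂ, (∀ i, W i t = ψ i) ∧
      ∀ s, ∑ i ∈ Q, W i s * star (W i s) = if s ∈ Q then 1 else 0 := by
  set w : ι → ℝ := fun i => ψ i - if i = t then 1 else 0 with hw
  have hwQ : ∀ i ∉ Q, w i = 0 := by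
    intro i hi
    have : i ≠ t := fun h => hi (h ▸ ht)
    simp [hw, hQ i hi, this]
  have hww : ∑ i, w i * w i = 2 * (1 - ψ t) := by
    have : ∀ i, w i * w i = ψ i ^ 2 - (if i = t then 2 * ψ i else 0) + if i = t then 1 else 0 := by
      intro i; simp only [hw]; split_ifs <;> ring
    simp only [this, Finset.sum_add_distrib, Finset.sum_sub_distrib, hψ]
    simp
    ring
  have hw0 : ψ t = 1 → ∀ i, w i = 0 := by
    intro h1 i
    rw [h1] at hww
    have h2 := (Finset.sum_eq_zero_iff_of_nonneg (fun i _ => mul_self_nonneg (w i))).1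
      (hww.trans (by ring)) i (Finset.mem_univ i)
    exact mul_self_eq_zero.1 h2
  -- Householder reflection along `w = ψ - e_t`, with `c = 2 / ‖w‖²`. If `ψ = e_t`, then `w = 0` and
  -- the reflection degenerates to the identity.
  set c : ℝ := 1 / (1 - ψ t) with hc
  have hcc : ∀ i, c * (c * (2 * (1 - ψ t))) * w i = 2 * c * w i := by
    intro i
    by_cases h1 : ψ t = 1
    · simp [hw0 h1 i]
    · have : 1 - ψ t ≠ 0 := fun h => h1 (by linarith)
      rw [hc]; field_simp
  set R : Matrix ι ι ℝ := of fun i j => (if i = j then 1 else 0) - c * w i * w j with hR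
  have hRR : ∀ i j, ∑ l, R i l * R l j = if i = j then 1 else 0 := by
    intro i j
    have h1 : ∀ l, R i l * R l j = (if i = l then (if l = j then (1 : ℝ) else 0) else 0)
        - (if i = l then c * w l * w j else 0) - (if l = j then c * w i * w l else 0)
        + c * c * w i * w j * (w l * w l) := by
      intro l
      simp only [hR, of_apply]
      split_ifs <;> ring
    simp only [h1, Finset.sum_add_distrib, Finset.sum_sub_distrib, ← Finset.mul_sum, hww,
      Finset.sum_ite_eq, Finset.sum_ite_eq', Finset.mem_univ, if_true]
    linear_combination (w j) * hcc i
  have hsymm : ∀ i j, R i j = R j i := by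
    intro i j
    simp only [hR, of_apply, eq_comm (a := i)]
    ring
  have hblock : ∀ i ∉ Q, ∀ s ∈ Q, R i s = 0 := by
    intro i hi s hs
    have : i ≠ s := fun h => hi (h ▸ hs)
    simp [hR, this, hwQ i hi]
  refine ⟨R.map (fun x => (x : ℂ)), ?_, ?_, ?_⟩
  · rw [mem_unitaryGroup_iff]
    ext i j
    rw [mul_apply, one_apply]
    simp only [star_apply, map_apply, Complex.star_def, Complex.conj_ofReal]
    rw [Finset.sum_congr rfl (fun l _ => by rw [hsymm j l])]
    have := hRR i j
    split_ifs at this ⊢ <;> exact_mod_cast this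
  · intro i
    simp only [map_apply]
    norm_cast
    have h1 : w t = -(1 - ψ t) := by simp [hw]
    by_cases h2 : ψ t = 1
    · have h3 := hw0 h2 i
      simp only [hw] at h3
      simp only [hR, of_apply, hw0 h2 i]
      linarith
    · have : 1 - ψ t ≠ 0 := fun h => h2 (by linarith)
      have h4 : c * w i * w t = - w i := by rw [h1, hc]; field_simp
      simp only [hR, of_apply, h4]
      simp only [hw]
      ring
  · intro s
    simp only [map_apply, Complex.star_def, Complex.conj_ofReal]
    have hreal : ∑ i ∈ Q, R i s * R i s = if s ∈ Q then 1 else 0 := ?_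
    · split_ifs at hreal ⊢ <;> exact_mod_cast hreal
    split_ifs with hs
    · have := hRR s s
      rw [if_pos rfl] at this
      rw [← this, ← Finset.sum_subset (Finset.subset_univ Q)]
      · exact Finset.sum_congr rfl fun i _ => by rw [hsymm s i]
      · intro i _ hi
        rw [hblock i hi s hs, mul_zero]
    · exact Finset.sum_eq_zero fun i hi => by rw [hsymm, hblock s hs i hi, zero_mul]

/-- The average over all permutations that send `t` to `i`. -/
theorem le_of_forall_perm_sum_le {ι : Type*} [Fintype ι] [DecidableEq ι] {f : ι → ℝ} {c : ℝ}
    {Q : Finset ι} {t : ι} (ht : t ∈ Q)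
    (h : ∀ σ : Equiv.Perm ι, c * f (σ t) ≤ ∑ s ∈ Q, f (σ s)) (i : ι)
    (hcard : 1 < Fintype.card ι) :
    c * f i ≤ f i + ((Q.card : ℝ) - 1) / ((Fintype.card ι : ℝ) - 1) * (∑ j, f j - f i) := by
  set P : Finset (Equiv.Perm ι) := Finset.univ.filter fun σ => σ t = i with hP
  have hPpos : 0 < (P.card : ℝ) := by
    have : P.Nonempty := ⟨Equiv.swap t i, by simp [hP]⟩
    exact_mod_cast this.card_pos
  set T : ι → ℝ := fun s => ∑ σ ∈ P, f (σ s) with hT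
  -- Composing with the swap of `s` and `s'` permutes `P`, because the swap fixes `t`.
  have hT_eq : ∀ s ≠ t, ∀ s' ≠ t, T s = T s' := by
    intro s hs s' hs'
    refine Finset.sum_bij (fun σ _ => σ * Equiv.swap s s') ?_ ?_ ?_ ?_
    · intro σ hσ
      simp only [hP, Finset.mem_filter, Finset.mem_univ, true_and] at hσ ⊢
      rw [Equiv.Perm.mul_apply, Equiv.swap_apply_of_ne_of_ne hs.symm hs'.symm, hσ]
    · intro σ _ τ _ h
      exact mul_right_cancel h
    · intro σ hσ
      refine ⟨σ * Equiv.swap s s', ?_, by simp [mul_assoc]⟩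
      simp only [hP, Finset.mem_filter, Finset.mem_univ, true_and] at hσ ⊢
      rw [Equiv.Perm.mul_apply, Equiv.swap_apply_of_ne_of_ne hs.symm hs'.symm, hσ]
    · intro σ _
      simp
  have hTt : T t = P.card * f i := by
    rw [hT]
    simp only
    rw [Finset.sum_congr rfl (g := fun _ => f i) (fun σ hσ => by
      rw [(Finset.mem_filter.1 hσ).2])]
    simp
  have hTsum : ∑ s, T s = P.card * ∑ j, f j := by
    simp only [hT]
    rw [Finset.sum_comm]
    simp [Equiv.sum_comp]
  obtain ⟨s₀, hs₀⟩ : ∃ s₀, s₀ ≠ t := by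
    have := Fintype.one_lt_card_iff_nontrivial.1 hcard
    exact exists_ne t
  have hmain : c * T t ≤ ∑ s ∈ Q, T s := by
    simp only [hT]
    rw [Finset.sum_comm, Finset.mul_sum]
    exact Finset.sum_le_sum fun σ _ => h σ
  have hsplit : ∀ A : Finset ι, t ∈ A → ∑ s ∈ A, T s = T t + ((A.card : ℝ) - 1) * T s₀ := by
    intro A hA
    rw [← Finset.add_sum_erase A T hA, Finset.sum_congr rfl (g := fun _ => T s₀) (fun s hs =>
      hT_eq s (Finset.ne_of_mem_erase hs) s₀ hs₀), Finset.sum_const, Finset.card_erase_of_mem hA,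
      nsmul_eq_mul, Nat.cast_sub (Finset.card_pos.2 ⟨t, hA⟩)]
    simp
  have h1 := hsplit Finset.univ (Finset.mem_univ t)
  rw [hTsum, hTt, Finset.card_univ] at h1
  rw [hsplit Q ht, hTt] at hmain
  have hc1 : (0 : ℝ) < (Fintype.card ι : ℝ) - 1 := by
    have : (1 : ℝ) < Fintype.card ι := by exact_mod_cast hcard
    linarith
  have h2 : T s₀ = P.card * ((∑ j, f j - f i) / ((Fintype.card ι : ℝ) - 1)) := by
    field_simp; linarith
  rw [h2] at hmain
  refine le_of_mul_le_mul_left ?_ hPpos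
  calc _ = c * (P.card * f i) := by ring
    _ ≤ _ := hmain
    _ = _ := by ring

/-- If every unitary conjugate of `ρ` satisfies a linear inequality given by a projection and a
real unit vector in its range, then the eigenvalues of `ρ` are bounded accordingly. -/
theorem eigenvalues_le_of_forall_unitary {ι : Type*} [Fintype ι] [DecidableEq ι]
    {ρ : Matrix ι ι ℂ} (hρ : ρ ∈ density ι) (h : ρ.IsHermitian) {ψ : ι → ℝ}
    (hψ : ∑ i, ψ i ^ 2 = 1) {Q : Finset ι} (hQ : ∀ i ∉ Q, ψ i = 0) {t : ι} (ht : t ∈ Q) {c : ℝ}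
    (hU : ∀ U ∈ unitaryGroup ι ℂ, c * (∑ i, ∑ j, (ψ i : ℂ) * (U * ρ * star U) i j * ψ j).re ≤
      (∑ i ∈ Q, (U * ρ * star U) i i).re) (hcard : 1 < Fintype.card ι) (i : ι) :
    c * h.eigenvalues i ≤ h.eigenvalues i +
      ((Q.card : ℝ) - 1) / ((Fintype.card ι : ℝ) - 1) * (1 - h.eigenvalues i) := by
  have hsum : ∑ i, h.eigenvalues i = 1 := by
    have := hρ.2
    rw [h.trace_eq_sum_eigenvalues] at this
    simpa using congrArg Complex.re this
  -- Only the `1` in `1 - h.eigenvalues i` is to become the sum of the eigenvalues.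
  nth_rw 3 [← hsum]
  refine le_of_forall_perm_sum_le ht (fun σ => ?_) i hcard
  obtain ⟨W, hW, hcol, hblock⟩ := exists_unitary_col_eq hψ hQ ht
  obtain ⟨U, hUu, hUe⟩ := exists_unitary_conj_eq h hW σ
  have h1 := hU U hUu
  rw [hUe] at h1
  have hent : ∀ i j, (W * diagonal (fun i => (h.eigenvalues (σ i) : ℂ)) * star W) i j =
      ∑ s, (h.eigenvalues (σ s) : ℂ) * (W i s * star (W j s)) := by
    intro i j
    rw [mul_apply]
    refine Finset.sum_congr rfl fun s _ => ?_
    rw [mul_diagonal, star_apply]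
    ring
  have hWW : ∀ s, ∑ i, (ψ i : ℂ) * W i s = if s = t then 1 else 0 := by
    intro s
    have := congrFun (congrFun (mem_unitaryGroup_iff'.1 hW) t) s
    rw [mul_apply, one_apply] at this
    simp only [star_apply, hcol, Complex.star_def, Complex.conj_ofReal] at this
    rw [this]
    simp only [eq_comm]
  have hWW' : ∀ s, ∑ i, star (W i s) * (ψ i : ℂ) = if s = t then 1 else 0 := by
    intro s
    have := congrArg star (hWW s)
    rw [star_sum] at this
    simp only [star_mul, Complex.star_def, Complex.conj_ofReal] at this ⊢
    rw [this]
    split_ifs <;> simp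
  -- Since column `t` of `W` is `ψ`, the quadratic form at `ψ` picks out the eigenvalue with index
  -- `σ t`; the block structure of `W` makes the trace over `Q` the sum of those with index in `σ
  -- Q`.
  have hL : ∑ i, ∑ j, (ψ i : ℂ) * (W * diagonal (fun i => (h.eigenvalues (σ i) : ℂ)) * star W) i j
      * ψ j = h.eigenvalues (σ t) := by
    have : ∀ i j, (ψ i : ℂ) * (W * diagonal (fun i => (h.eigenvalues (σ i) : ℂ)) * star W) i j
        * ψ j = ∑ s, (h.eigenvalues (σ s) : ℂ) * ((ψ i * W i s) * (star (W j s) * ψ j)) := by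
      intro i j
      rw [hent, Finset.mul_sum, Finset.sum_mul]
      exact Finset.sum_congr rfl fun s _ => by ring
    simp only [this]
    rw [Finset.sum_congr rfl fun i _ => Finset.sum_comm, Finset.sum_comm]
    simp only [← Finset.mul_sum, ← Finset.sum_mul, hWW, hWW']
    simp
  have hR : ∑ i ∈ Q, (W * diagonal (fun i => (h.eigenvalues (σ i) : ℂ)) * star W) i i =
      ∑ s ∈ Q, (h.eigenvalues (σ s) : ℂ) := by
    simp only [hent]
    rw [Finset.sum_comm]
    simp only [← Finset.mul_sum, hblock]
    simp
  rw [hL, hR] at h1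
  have h2 : (∑ s ∈ Q, (h.eigenvalues (σ s) : ℂ)).re = ∑ s ∈ Q, h.eigenvalues (σ s) := by
    simp
  rwa [h2, Complex.ofReal_re] at h1

/-! ### The ball `SEPBALL` -/

theorem trace_sq_eq_sum_eigenvalues_sq {ι : Type*} [Fintype ι] [DecidableEq ι]
    {ρ : Matrix ι ι ℂ} (h : ρ.IsHermitian) :
    (ρ ^ 2).trace.re = ∑ i, h.eigenvalues i ^ 2 := by
  obtain ⟨U, hU, hUe⟩ := exists_unitary_conj_eq h (one_mem (unitaryGroup ι ℂ)) 1
  have hUU := mem_unitaryGroup_iff'.1 hU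
  have h1 : (ρ ^ 2).trace = ((U * ρ * star U) * (U * ρ * star U)).trace := by
    have : (U * ρ * star U) * (U * ρ * star U) = U * (ρ * (star U * U) * ρ) * star U := by
      simp only [mul_assoc]
    rw [this, hUU, trace_mul_comm, ← mul_assoc, hUU, one_mul, mul_one, sq]
  rw [h1, hUe, one_mul, star_one, mul_one, diagonal_mul_diagonal, trace_diagonal]
  simp [sq]

theorem sum_eigenvalues_eq_one {ι : Type*} [Fintype ι] [DecidableEq ι]
    {ρ : Matrix ι ι ℂ} (hρ : ρ ∈ density ι) (h : ρ.IsHermitian) :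
    ∑ i, h.eigenvalues i = 1 := by
  have := hρ.2
  rw [h.trace_eq_sum_eigenvalues] at this
  simpa using congrArg Complex.re this

theorem diagonal_spike_mem_density {ι : Type*} [Fintype ι] [DecidableEq ι] (t : ι) {a b : ℝ}
    (ha : 0 ≤ a) (hb : 0 ≤ b) (h : a + ((Fintype.card ι : ℝ) - 1) * b = 1) :
    (diagonal fun i => (spike t a b i : ℂ)) ∈ density ι := by
  refine ⟨PosSemidef.diagonal fun i => ?_, ?_⟩
  · simp only [Pi.zero_apply, Complex.zero_le_real]
    rw [spike]; split_ifs <;> assumption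
  · rw [trace_diagonal, ← Complex.ofReal_sum, sum_spike, h, Complex.ofReal_one]

/-- Cauchy–Schwarz on the other `d - 1` entries gives `(1 - x)² ≤ 1 - (d - 1) x²` for `x = f i`,
that is `d x² ≤ 2 x`. -/
theorem sq_le_of_sum_sq_le {ι : Type*} [Fintype ι] [DecidableEq ι] {f : ι → ℝ}
    (hf : ∑ i, f i = 1) (hd : 1 < Fintype.card ι)
    (h : ∑ i, f i ^ 2 ≤ 1 / ((Fintype.card ι : ℝ) - 1)) (i : ι) :
    f i ≤ 2 / (Fintype.card ι : ℝ) := by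
  have hd' : (1 : ℝ) < Fintype.card ι := by exact_mod_cast hd
  have h1 := Finset.add_sum_erase Finset.univ f (Finset.mem_univ i)
  have h2 := Finset.add_sum_erase Finset.univ (fun j => f j ^ 2) (Finset.mem_univ i)
  have h3 := sq_sum_le_card_mul_sum_sq (s := Finset.univ.erase i) (f := f)
  rw [Finset.card_erase_of_mem (Finset.mem_univ i), Finset.card_univ,
    Nat.cast_sub hd.le] at h3
  rw [hf] at h1
  rw [le_div_iff₀ (by linarith)] at h ⊢
  have h4 : ∑ j ∈ Finset.univ.erase i, f j = 1 - f i := by linarith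
  rw [h4] at h3
  push_cast at h3
  have h5 : f i * (f i * (Fintype.card ι : ℝ) - 2) ≤ 0 := by nlinarith
  by_contra hcon
  push Not at hcon
  have hfi : 0 < f i := by
    by_contra hn
    push Not at hn
    nlinarith
  nlinarith

theorem Lambda_SEPBALL {n k : ℕ} (hn : 2 ≤ n) (hk : 2 ≤ k) :
    Lambda (spectra (SEPBALL n k)) = 2 / ((n : ℝ) * k) := by
  have hd : 4 ≤ n * k := Nat.mul_le_mul hn hk
  have hd' : (4 : ℝ) ≤ (n : ℝ) * k := by exact_mod_cast hd
  have hcard : (Fintype.card (Fin n × Fin k) : ℝ) = n * k := by simp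
  have hcard1 : 1 < Fintype.card (Fin n × Fin k) := by simp; omega
  set D : ℝ := (n : ℝ) * k with hD
  -- The value of `b` is forced by unit trace with `a = 2 / D`; equal remaining entries give
  -- equality in Cauchy–Schwarz.
  refine Lambda_spectra_eq (t := (⟨0, by omega⟩, ⟨0, by omega⟩))
    (b := (D - 2) / (D * (D - 1))) (fun ρ hρ => hρ.1) ?_ ?_
  · intro ρ hρ h i
    have h1 := hρ.2
    rw [trace_sq_eq_sum_eigenvalues_sq h] at h1
    rw [← hcard]
    refine sq_le_of_sum_sq_le (sum_eigenvalues_eq_one hρ.1 h) hcard1 ?_ i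
    rwa [hcard]
  · have hD0 : D ≠ 0 := by linarith
    have hD1 : D - 1 ≠ 0 := by linarith
    refine ⟨diagonal_spike_mem_density _ (by positivity) ?_ ?_, ?_⟩
    · apply div_nonneg <;> nlinarith
    · rw [hcard]; field_simp; ring
    · rw [sq, diagonal_mul_diagonal, trace_diagonal]
      have h1 : ∀ i, ((spike ((⟨0, by omega⟩, ⟨0, by omega⟩) : Fin n × Fin k) (2 / D)
          ((D - 2) / (D * (D - 1))) i : ℝ) : ℂ) *
          ((spike ((⟨0, by omega⟩, ⟨0, by omega⟩) : Fin n × Fin k) (2 / D)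
          ((D - 2) / (D * (D - 1))) i : ℝ) : ℂ) =
          ((spike ((⟨0, by omega⟩, ⟨0, by omega⟩) : Fin n × Fin k) ((2 / D) ^ 2)
          (((D - 2) / (D * (D - 1))) ^ 2) i : ℝ) : ℂ) := by
        intro i
        simp only [spike]
        split_ifs <;> (push_cast; ring)
      simp only [h1]
      rw [← Complex.ofReal_sum, sum_spike, hcard, Complex.ofReal_re]
      apply le_of_eq
      rw [← hD]
      field_simp
      ring

/-! ### Upper bounds for `APPT` and `ARED` -/

section maxEnt

variable {n k r : ℕ} (hrn : r ≤ n) (hrk : r ≤ k)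

/-- The maximally entangled unit vector of Schmidt rank `r`. -/
noncomputable def maxEnt (x : Fin n × Fin k) : ℝ :=
  ∑ i : Fin r, if x = (Fin.castLE hrn i, Fin.castLE hrk i) then 1 / √(r : ℝ) else 0

theorem sum_maxEnt_mul (F : Fin n × Fin k → ℂ) :
    ∑ x, (maxEnt hrn hrk x : ℂ) * F x =
      (1 / √(r : ℝ) : ℝ) * ∑ i : Fin r, F (Fin.castLE hrn i, Fin.castLE hrk i) := by
  simp only [maxEnt, Complex.ofReal_sum, Finset.sum_mul]
  rw [Finset.sum_comm, Finset.mul_sum]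
  refine Finset.sum_congr rfl fun i _ => ?_
  rw [Finset.sum_eq_single (Fin.castLE hrn i, Fin.castLE hrk i)]
  · simp
  · intro x _ hx; simp [hx]
  · simp

theorem sum_sum_maxEnt_mul (F : BiMat n k) :
    ∑ x, ∑ y, (maxEnt hrn hrk x : ℂ) * F x y * maxEnt hrn hrk y =
      (1 / (r : ℝ) : ℝ) * ∑ i : Fin r, ∑ j : Fin r,
        F (Fin.castLE hrn i, Fin.castLE hrk i) (Fin.castLE hrn j, Fin.castLE hrk j) := by
  have h1 : ∀ x, ∑ y, (maxEnt hrn hrk x : ℂ) * F x y * maxEnt hrn hrk y =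
      maxEnt hrn hrk x * ∑ y, (maxEnt hrn hrk y : ℂ) * F x y := by
    intro x
    rw [Finset.mul_sum]
    exact Finset.sum_congr rfl fun y _ => by ring
  simp only [h1, sum_maxEnt_mul]
  rw [← Finset.mul_sum, ← mul_assoc, ← Complex.ofReal_mul, div_mul_div_comm,
    Real.mul_self_sqrt (Nat.cast_nonneg r), one_mul]

theorem maxEnt_diag (i : Fin r) :
    maxEnt hrn hrk (Fin.castLE hrn i, Fin.castLE hrk i) = 1 / √(r : ℝ) := by
  simp [maxEnt, Prod.ext_iff, (Fin.castLE_injective _).eq_iff]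

theorem sum_maxEnt_sq (hr : 1 ≤ r) : ∑ x, maxEnt hrn hrk x ^ 2 = 1 := by
  have h := sum_maxEnt_mul hrn hrk (fun x => (maxEnt hrn hrk x : ℂ))
  simp only [maxEnt_diag] at h
  have h1 : (∑ x, maxEnt hrn hrk x * maxEnt hrn hrk x : ℝ) =
      1 / √(r : ℝ) * ∑ i : Fin r, 1 / √(r : ℝ) := by exact_mod_cast h
  have hr0 : (0 : ℝ) < r := by exact_mod_cast hr
  simp only [sq, h1]
  rw [Finset.sum_const, Finset.card_univ, Fintype.card_fin, nsmul_eq_mul]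
  have := Real.mul_self_sqrt hr0.le
  have h2 : √(r : ℝ) ≠ 0 := (Real.sqrt_pos.2 hr0).ne'
  field_simp
  nlinarith

/-- The index set of the leading `r × s` corner. -/
def corner {s : ℕ} (hsk : s ≤ k) : Finset (Fin n × Fin k) :=
  Finset.univ.map ((Fin.castLEEmb hrn).prodMap (Fin.castLEEmb hsk))

theorem card_corner {s : ℕ} (hsk : s ≤ k) : (corner hrn hsk).card = r * s := by
  simp [corner]

theorem sum_corner {s : ℕ} (hsk : s ≤ k) (F : Fin n × Fin k → ℂ) :
    ∑ x ∈ corner hrn hsk, F x =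
      ∑ i : Fin r, ∑ j : Fin s, F (Fin.castLE hrn i, Fin.castLE hsk j) := by
  rw [corner, Finset.sum_map, Fintype.sum_prod_type]
  rfl

theorem mem_corner {s : ℕ} (hsk : s ≤ k) (i : Fin r) (j : Fin s) :
    (Fin.castLE hrn i, Fin.castLE hsk j) ∈ corner hrn hsk :=
  Finset.mem_map.2 ⟨(i, j), Finset.mem_univ _, rfl⟩

theorem maxEnt_eq_zero {s : ℕ} (hrs : r ≤ s) (hsk : s ≤ k) (x : Fin n × Fin k)
    (hx : x ∉ corner hrn hsk) : maxEnt hrn hrk x = 0 := by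
  refine Finset.sum_eq_zero fun i _ => if_neg ?_
  rintro rfl
  exact hx (mem_corner hrn hsk i (Fin.castLE hrs i))

end maxEnt

theorem mul_conj_unitary_mem_density {ι : Type*} [Fintype ι] [DecidableEq ι] {ρ U : Matrix ι ι ℂ}
    (hρ : ρ ∈ density ι) (hU : U ∈ unitaryGroup ι ℂ) : U * ρ * star U ∈ density ι := by
  refine ⟨hρ.1.mul_mul_conjTranspose_same U, ?_⟩
  rw [trace_mul_comm, ← mul_assoc, mem_unitaryGroup_iff'.1 hU, one_mul, hρ.2]

theorem idTensor_transpose_apply {n k : ℕ} (X : BiMat n k) (x y : Fin n × Fin k) :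
    idTensor transpose X x y = X (x.1, y.2) (y.1, x.2) := rfl

theorem idTensor_reductionMap_apply {n k : ℕ} (X : BiMat n k) (x y : Fin n × Fin k) :
    idTensor reductionMap X x y =
      (if x.2 = y.2 then ∑ c, X (x.1, c) (y.1, c) else 0) - X x y := by
  simp [idTensor, reductionMap, trace, one_apply]

/-- Schmidt rank two suffices: `2 ⟨ψ, τ ψ⟩` is at most the trace of `τ` over a `2 × 2` corner, so
averaging gives `2 x ≤ x + 3 (1 - x) / (n k - 1)`. -/
theorem eigenvalues_le_of_mem_APPT {n k : ℕ} (hn : 2 ≤ n) (hk : 2 ≤ k) {ρ : BiMat n k}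
    (hρ : ρ ∈ APPT n k) (h : ρ.IsHermitian) (i : Fin n × Fin k) :
    h.eigenvalues i ≤ 3 / ((n : ℝ) * k + 2) := by
  have hd : 4 ≤ n * k := Nat.mul_le_mul hn hk
  have hd' : (4 : ℝ) ≤ (n : ℝ) * k := by exact_mod_cast hd
  have hcard : (Fintype.card (Fin n × Fin k) : ℝ) = n * k := by simp
  have hcard1 : 1 < Fintype.card (Fin n × Fin k) := by simp; omega
  have key := eigenvalues_le_of_forall_unitary (c := 2) hρ.1 h
    (sum_maxEnt_sq hn hk one_le_two) (maxEnt_eq_zero hn hk le_rfl hk)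
    (mem_corner hn hk 0 0) ?_ hcard1 i
  · rw [card_corner, hcard] at key
    rw [le_div_iff₀ (by linarith)]
    have h1 : (0 : ℝ) < (n : ℝ) * k - 1 := by linarith
    rw [div_mul_eq_mul_div, ← sub_le_iff_le_add', le_div_iff₀ h1] at key
    push_cast at key
    nlinarith
  · intro U hU
    have hP := (hρ.2 U hU).2
    generalize U * ρ * star U = τ at hP
    rw [sum_sum_maxEnt_mul, sum_corner hn hk (fun x => τ x x)]
    -- At the antisymmetric vector `e₀₁ - e₁₀`, the partial transpose turns the cross terms into the
    -- `(00, 11)` coherences, which occur in `2 ⟨ψ, τ ψ⟩`.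
    have h1 := hP.dotProduct_mulVec_nonneg
      (Pi.single (Fin.castLE hn 0, Fin.castLE hk 1) 1 -
        Pi.single (Fin.castLE hn 1, Fin.castLE hk 0) 1)
    simp only [mulVec_sub, star_sub, sub_dotProduct, dotProduct_sub, ← Pi.single_star, star_one,
      mulVec_single_one, single_one_dotProduct, col_apply, idTensor_transpose_apply] at h1
    have h2 := (Complex.le_def.1 h1).1
    simp only [Fin.sum_univ_two, Complex.re_ofReal_mul, Complex.add_re, Complex.sub_re,
      Complex.zero_re] at h2 ⊢
    push_cast
    linarith

/-- Testing the reduction map at the maximally entangled vector `ψ` of rank `r` bounds `r ⟨ψ, τ ψ⟩`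
by the trace of `τ` over the `r × k` corner. -/
theorem eigenvalues_le_of_mem_ARED {n k r : ℕ} (hr : 1 ≤ r) (hrn : r ≤ n) (hrk : r ≤ k)
    (hd : 1 < n * k) {ρ : BiMat n k}
    (hρ : ρ ∈ ARED n k) (h : ρ.IsHermitian) (i : Fin n × Fin k) :
    r * h.eigenvalues i ≤ h.eigenvalues i +
      ((r : ℝ) * k - 1) / ((n : ℝ) * k - 1) * (1 - h.eigenvalues i) := by
  have hcard : (Fintype.card (Fin n × Fin k) : ℝ) = n * k := by simp
  have hcard1 : 1 < Fintype.card (Fin n × Fin k) := by simpa using hd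
  have key := eigenvalues_le_of_forall_unitary (c := r) hρ.1 h
    (sum_maxEnt_sq hrn hrk hr) (maxEnt_eq_zero hrn hrk hrk le_rfl)
    (mem_corner hrn le_rfl ⟨0, hr⟩ ⟨0, hr.trans hrk⟩) ?_ hcard1 i
  · rw [card_corner, hcard] at key
    exact_mod_cast key
  · intro U hU
    have hP := (hρ.2 U hU).2
    generalize U * ρ * star U = τ at hP
    have h1 := hP.dotProduct_mulVec_nonneg (fun x => (maxEnt hrn hrk x : ℂ))
    have h2 : star (fun x => (maxEnt hrn hrk x : ℂ)) ⬝ᵥ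
        idTensor reductionMap τ *ᵥ (fun x => (maxEnt hrn hrk x : ℂ)) =
        ∑ x, ∑ y, (maxEnt hrn hrk x : ℂ) * idTensor reductionMap τ x y * maxEnt hrn hrk y := by
      simp [dotProduct, mulVec, Finset.mul_sum, mul_assoc]
    rw [h2, sum_sum_maxEnt_mul] at h1
    rw [sum_sum_maxEnt_mul, sum_corner hrn le_rfl (fun x => τ x x)]
    simp only [idTensor_reductionMap_apply, Finset.sum_sub_distrib,
      (Fin.castLE_injective hrk).eq_iff, Finset.sum_ite_eq, Finset.mem_univ, if_true] at h1
    have h3 := (Complex.le_def.1 h1).1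
    have hr0 : (0 : ℝ) < r := by exact_mod_cast hr
    rw [Complex.re_ofReal_mul, Complex.sub_re, Complex.zero_re] at h3
    rw [Complex.re_ofReal_mul, ← mul_assoc, mul_one_div, div_self hr0.ne', one_mul]
    have h4 := nonneg_of_mul_nonneg_right h3 (by positivity)
    exact sub_nonneg.1 h4

/-! ### Unitary conjugates of a spiked spectrum -/

theorem exists_conj_diagonal_spike {ι : Type*} [Fintype ι] [DecidableEq ι] (t : ι) (a b : ℝ)
    {U : Matrix ι ι ℂ} (hU : U ∈ unitaryGroup ι ℂ) :
    ∃ u : ι → ℂ, ∑ i, ‖u i‖ ^ 2 = 1 ∧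
      U * diagonal (fun i => (spike t a b i : ℂ)) * star U =
        (b : ℂ) • 1 + ((a - b : ℝ) : ℂ) • vecMulVec u (star u) := by
  refine ⟨fun i => U i t, ?_, ?_⟩
  · have h := congrFun (congrFun (mem_unitaryGroup_iff'.1 hU) t) t
    rw [mul_apply, one_apply_eq] at h
    simp only [star_apply, Complex.star_def, Complex.conj_mul'] at h
    exact_mod_cast h
  · have h1 : diagonal (fun i => (spike t a b i : ℂ)) =
        (b : ℂ) • 1 + ((a - b : ℝ) : ℂ) • vecMulVec (Pi.single t 1) (Pi.single t 1) := by
      ext i j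
      by_cases hij : i = j
      · subst hij
        by_cases hi : i = t <;> simp [spike, hi, vecMulVec_apply]
      · by_cases hi : i = t
        · subst hi
          simp [hij, vecMulVec_apply, Ne.symm hij, one_apply]
        · simp [hij, vecMulVec_apply, Pi.single_apply, hi, one_apply]
    rw [h1, mul_add, add_mul, mul_smul_comm, smul_mul_assoc, mul_one,
      mem_unitaryGroup_iff.1 hU, mul_smul_comm, smul_mul_assoc]
    congr 2
    rw [mul_vecMulVec, vecMulVec_mul]
    ext i j
    simp [vecMulVec_apply]

/-! ### Lower bound for `ARED` -/

theorem norm_sum_mul_sq_le {ι : Type*} (s : Finset ι) (f g : ι → ℂ) :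
    ‖∑ i ∈ s, f i * g i‖ ^ 2 ≤ (∑ i ∈ s, ‖f i‖ ^ 2) * ∑ i ∈ s, ‖g i‖ ^ 2 := by
  refine le_trans ?_ (Finset.sum_mul_sq_le_sq_mul_sq s (fun i => ‖f i‖) (fun i => ‖g i‖))
  gcongr
  refine (norm_sum_le _ _).trans (le_of_eq ?_)
  simp

theorem norm_sum_sq_le {ι : Type*} (s : Finset ι) (f : ι → ℂ) :
    ‖∑ i ∈ s, f i‖ ^ 2 ≤ s.card * ∑ i ∈ s, ‖f i‖ ^ 2 := by
  simpa using norm_sum_mul_sq_le s (fun _ => 1) f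

theorem norm_trace_sq_le_card_mul {ι : Type*} [Fintype ι] (X : Matrix ι ι ℂ) :
    ‖X.trace‖ ^ 2 ≤ Fintype.card ι * ∑ i, ∑ j, ‖X i j‖ ^ 2 := by
  refine (norm_sum_sq_le _ _).trans ?_
  rw [Finset.card_univ]
  gcongr with i
  exact Finset.single_le_sum (f := fun j => ‖X i j‖ ^ 2) (fun j _ => by positivity)
    (Finset.mem_univ i)

theorem trace_mul_conjTranspose_self {ι κ : Type*} [Fintype ι] [Fintype κ]
    (X : Matrix ι κ ℂ) : (X * Xᴴ).trace = ((∑ i, ∑ j, ‖X i j‖ ^ 2 : ℝ) : ℂ) := by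
  simp [trace, mul_apply, Complex.mul_conj']

/-- The trace of a matrix that factors through dimension `m` is at most `√m` times its
Frobenius norm. -/
theorem norm_trace_conjTranspose_mul_sq_le {ι κ : Type*} [Fintype ι] [Fintype κ] [DecidableEq ι]
    (A N : Matrix ι κ ℂ) :
    ‖(Nᴴ * A).trace‖ ^ 2 ≤ Fintype.card ι * ∑ i, ∑ j, ‖(Nᴴ * A) i j‖ ^ 2 := by
  have hG : (A * Aᴴ).IsHermitian := isHermitian_mul_conjTranspose_self A
  -- Multiplying `A` and `N` by `U` leaves `Nᴴ * A` unchanged and makes the rows of `A` orthogonal.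
  -- The Frobenius norm then splits over rows, and Cauchy–Schwarz applies across the rows and within
  -- each.
  obtain ⟨U, hU, hUe⟩ := exists_unitary_conj_eq hG (one_mem (unitaryGroup ι ℂ)) 1
  have hUU := mem_unitaryGroup_iff'.1 hU
  rw [star_eq_conjTranspose] at hUU
  have hX : Nᴴ * A = (U * N)ᴴ * (U * A) := by
    rw [conjTranspose_mul, Matrix.mul_assoc, ← Matrix.mul_assoc Uᴴ, hUU, Matrix.one_mul]
  have hD : (U * A) * (U * A)ᴴ = diagonal (fun i => (hG.eigenvalues i : ℂ)) := by
    rw [one_mul, star_one, mul_one] at hUe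
    rw [conjTranspose_mul, ← star_eq_conjTranspose U]
    simpa only [Matrix.mul_assoc, Equiv.Perm.coe_one, id] using hUe
  rw [hX]
  generalize U * A = B at *
  generalize U * N = M at *
  generalize hG.eigenvalues = D at *
  have hDB : ∀ i, ∑ c, ‖B i c‖ ^ 2 = D i := by
    intro i
    have := congrFun (congrFun hD i) i
    rw [mul_apply, diagonal_apply_eq] at this
    simp only [conjTranspose_apply, Complex.star_def, Complex.mul_conj'] at this
    exact_mod_cast this
  have hF : ∑ i, ∑ j, ‖(Mᴴ * B) i j‖ ^ 2 = ∑ i, (∑ c, ‖M i c‖ ^ 2) * D i := by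
    have h1 := trace_mul_conjTranspose_self (Mᴴ * B)
    rw [conjTranspose_mul, conjTranspose_conjTranspose, Matrix.mul_assoc, ← Matrix.mul_assoc B,
      hD, trace_mul_comm, Matrix.mul_assoc, trace_mul_comm] at h1
    have h2 : (M * Mᴴ * diagonal (fun i => (D i : ℂ))).trace =
        ((∑ i, (∑ c, ‖M i c‖ ^ 2) * D i : ℝ) : ℂ) := by
      simp only [trace, diag_apply, mul_diagonal]
      simp only [mul_apply, conjTranspose_apply, Complex.star_def, Complex.mul_conj']
      push_cast
      rfl
    rw [h2] at h1
    exact_mod_cast h1.symm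
  have ht : (Mᴴ * B).trace = ∑ i, ∑ c, star (M i c) * B i c := by
    rw [Finset.sum_comm]
    simp [trace, mul_apply]
  rw [ht, hF]
  refine (norm_sum_sq_le _ _).trans ?_
  rw [Finset.card_univ]
  gcongr with i
  rw [← hDB i]
  refine (norm_sum_mul_sq_le _ _ _).trans (le_of_eq ?_)
  simp

/-- Reshape `u` and `φ` into `n × k` matrices `A` and `N`. The reduction part of the form at `φ` is
`‖X‖² - |Tr X|²` with `X = Nᴴ A`. A share `1/r` of `|Tr X|²` is absorbed by `‖X‖²`, as `X` is `k ×
k` and factors through dimension `n`; the share `1 - 1/r` by `‖φ‖²`, as `Tr X = ⟨φ, u⟩`. -/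
theorem posSemidef_idTensor_reductionMap {n k r : ℕ} (hr : 1 ≤ r) (hrk : r = n ∨ r = k)
    {u : Fin n × Fin k → ℂ} (hu : ∑ x, ‖u x‖ ^ 2 = 1) :
    (((1 - 1 / r : ℝ) : ℂ) • (1 : BiMat n k) +
      idTensor reductionMap (vecMulVec u (star u))).PosSemidef := by
  refine PosSemidef.of_dotProduct_mulVec_nonneg ?_ fun φ => ?_
  · ext x y
    simp only [conjTranspose_apply, Matrix.add_apply, Matrix.smul_apply, smul_eq_mul,
      idTensor_reductionMap_apply, vecMulVec_apply, star_add, star_sub, star_mul, Pi.star_apply,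
      star_star, one_apply, eq_comm (a := y), eq_comm (a := y.2)]
    congr 1
    · split_ifs <;> simp
    · congr 1
      split_ifs
      · rw [star_sum]
        exact Finset.sum_congr rfl fun c _ => by rw [star_mul, star_star]
      · simp
  · set A : Matrix (Fin n) (Fin k) ℂ := of fun i c => u (i, c) with hA
    set N : Matrix (Fin n) (Fin k) ℂ := of fun i c => φ (i, c) with hN
    have htr : ∑ x, star (φ x) * u x = (Nᴴ * A).trace := by
      rw [Fintype.sum_prod_type, Finset.sum_comm]
      simp [trace, mul_apply, hA, hN]
    have hF : ∑ x : Fin n × Fin k, ∑ y : Fin n × Fin k,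
        star (φ x) * (if x.2 = y.2 then ∑ c, u (x.1, c) * star (u (y.1, c)) else 0) * φ y =
        ((∑ i, ∑ j, ‖(Nᴴ * A) i j‖ ^ 2 : ℝ) : ℂ) := by
      rw [← trace_mul_conjTranspose_self]
      have h1 : (Nᴴ * A * (Nᴴ * A)ᴴ).trace = (Nᴴ * (A * Aᴴ) * N).trace := by
        rw [conjTranspose_mul, conjTranspose_conjTranspose]; simp only [Matrix.mul_assoc]
      rw [h1]
      simp only [Fintype.sum_prod_type, trace, diag_apply, mul_apply, conjTranspose_apply, hA, hN,
        of_apply]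
      simp only [mul_ite, ite_mul, mul_zero, zero_mul, Finset.sum_ite_eq, Finset.mem_univ,
        if_true]
      rw [Finset.sum_comm]
      refine Finset.sum_congr rfl fun c _ => ?_
      rw [Finset.sum_comm]
      refine Finset.sum_congr rfl fun j _ => ?_
      rw [Finset.sum_mul]
    have hq : star φ ⬝ᵥ (((1 - 1 / r : ℝ) : ℂ) • (1 : BiMat n k) +
        idTensor reductionMap (vecMulVec u (star u))) *ᵥ φ =
        (((1 - 1 / r : ℝ) * ∑ x, ‖φ x‖ ^ 2 + ∑ i, ∑ j, ‖(Nᴴ * A) i j‖ ^ 2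
          - ‖(Nᴴ * A).trace‖ ^ 2 : ℝ) : ℂ) := by
      have h0 : star φ ⬝ᵥ idTensor reductionMap (vecMulVec u (star u)) *ᵥ φ =
          ((∑ i, ∑ j, ‖(Nᴴ * A) i j‖ ^ 2 : ℝ) : ℂ) - ((‖(Nᴴ * A).trace‖ ^ 2 : ℝ) : ℂ) := by
        rw [← hF, ← htr]
        push_cast
        rw [← Complex.mul_conj', map_sum, Finset.sum_mul_sum, ← Finset.sum_sub_distrib]
        simp only [dotProduct, mulVec, Finset.mul_sum]
        refine Finset.sum_congr rfl fun x _ => ?_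
        rw [← Finset.sum_sub_distrib]
        refine Finset.sum_congr rfl fun y _ => ?_
        rw [idTensor_reductionMap_apply]
        simp only [vecMulVec_apply, Pi.star_apply, Complex.star_def, map_mul, Complex.conj_conj]
        ring
      rw [add_mulVec, dotProduct_add, h0, smul_mulVec, one_mulVec, dotProduct_smul]
      have h2 : star φ ⬝ᵥ φ = ((∑ x, ‖φ x‖ ^ 2 : ℝ) : ℂ) := by
        simp [dotProduct, Complex.conj_mul']
      rw [h2]
      push_cast
      simp only [smul_eq_mul]
      ring
    rw [hq, Complex.zero_le_real]
    have hcs : ‖(Nᴴ * A).trace‖ ^ 2 ≤ ∑ x, ‖φ x‖ ^ 2 := by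
      rw [← htr]
      refine (norm_sum_mul_sq_le _ _ _).trans (le_of_eq ?_)
      rw [hu, mul_one]
      simp
    have hrF : ‖(Nᴴ * A).trace‖ ^ 2 ≤ r * ∑ i, ∑ j, ‖(Nᴴ * A) i j‖ ^ 2 := by
      rcases hrk with rfl | rfl
      · simpa using norm_trace_conjTranspose_mul_sq_le A N
      · simpa using norm_trace_sq_le_card_mul (Nᴴ * A)
    have hr1 : (1 : ℝ) ≤ r := by exact_mod_cast hr
    have h3 : 1 / (r : ℝ) * ‖(Nᴴ * A).trace‖ ^ 2 ≤ ∑ i, ∑ j, ‖(Nᴴ * A) i j‖ ^ 2 := by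
      rw [one_div, inv_mul_le_iff₀ (by linarith)]
      exact hrF
    have h4 : 0 ≤ 1 - 1 / (r : ℝ) := by
      rw [sub_nonneg, div_le_one (by linarith)]; exact hr1
    nlinarith [mul_le_mul_of_nonneg_left hcs h4]

/-- The reduction map sends the identity to `(k - 1)` times itself; `h2` makes that contribution
match the shift that compensates the negative part from `u u*`. -/
theorem diagonal_spike_mem_ARED {n k r : ℕ} (hr : 1 ≤ r) (hrk : r = n ∨ r = k)
    (t : Fin n × Fin k) {a b : ℝ} (hb : 0 ≤ b) (hba : b ≤ a)
    (h1 : a + ((n : ℝ) * k - 1) * b = 1) (h2 : b * (k - 1) = (a - b) * (1 - 1 / r)) :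
    (diagonal fun i => (spike t a b i : ℂ)) ∈ ARED n k := by
  have hd := diagonal_spike_mem_density t (hb.trans hba) hb (by simpa using h1)
  refine ⟨hd, fun U hU => ⟨mul_conj_unitary_mem_density hd hU, ?_⟩⟩
  obtain ⟨u, hu, he⟩ := exists_conj_diagonal_spike t a b hU
  rw [he]
  have h3 : idTensor reductionMap ((b : ℂ) • 1 + ((a - b : ℝ) : ℂ) • vecMulVec u (star u)) =
      ((a - b : ℝ) : ℂ) • (((1 - 1 / r : ℝ) : ℂ) • (1 : BiMat n k) +
        idTensor reductionMap (vecMulVec u (star u))) := by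
    have h2' := congrArg Complex.ofReal h2
    push_cast at h2'
    ext x y
    rw [smul_add, smul_smul]
    simp only [Matrix.add_apply, Matrix.smul_apply, smul_eq_mul, idTensor_reductionMap_apply,
      one_apply, Prod.ext_iff, Finset.sum_add_distrib, ← Finset.mul_sum, and_true]
    push_cast
    rw [← h2']
    by_cases hx1 : x.1 = y.1 <;> by_cases hx2 : x.2 = y.2 <;> simp [hx1, hx2] <;> ring
  rw [h3]
  refine (posSemidef_idTensor_reductionMap hr hrk hu).smul ?_
  rw [Complex.zero_le_real]
  linarith

theorem Lambda_ARED_of_le {n k : ℕ} (hk : 2 ≤ k) (hkn : k ≤ n) :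
    Lambda (spectra (ARED n k)) = ((k : ℝ) + 1) / (k * ((n : ℝ) + 1)) := by
  have hn : 2 ≤ n := hk.trans hkn
  have hd : 4 ≤ n * k := Nat.mul_le_mul hn hk
  have hd' : (4 : ℝ) ≤ (n : ℝ) * k := by exact_mod_cast hd
  have hk' : (2 : ℝ) ≤ k := by exact_mod_cast hk
  have hn' : (2 : ℝ) ≤ n := by exact_mod_cast hn
  refine Lambda_spectra_eq (t := (⟨0, by omega⟩, ⟨0, by omega⟩))
    (b := 1 / (k * ((n : ℝ) + 1))) (fun ρ hρ => hρ.1) ?_ ?_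
  · intro ρ hρ h i
    have key := eigenvalues_le_of_mem_ARED (by omega) hkn le_rfl (by omega) hρ h i
    rw [div_mul_eq_mul_div, ← sub_le_iff_le_add', le_div_iff₀ (by linarith)] at key
    rw [le_div_iff₀ (by positivity)]
    have h1 : (0 : ℝ) < k - 1 := by linarith
    refine le_of_mul_le_mul_left ?_ h1
    linarith
  · refine diagonal_spike_mem_ARED (r := k) (by omega) (Or.inr rfl) _ (by positivity) ?_ ?_ ?_
    · gcongr; linarith
    · field_simp; ring
    · field_simp; ring

theorem Lambda_ARED_of_ge {n k : ℕ} (hn : 2 ≤ n) (hnk : n ≤ k) :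
    Lambda (spectra (ARED n k)) = 1 / (n : ℝ) := by
  have hk : 2 ≤ k := hn.trans hnk
  have hd : 4 ≤ n * k := Nat.mul_le_mul hn hk
  have hd' : (4 : ℝ) ≤ (n : ℝ) * k := by exact_mod_cast hd
  have hk' : (2 : ℝ) ≤ k := by exact_mod_cast hk
  have hn' : (2 : ℝ) ≤ n := by exact_mod_cast hn
  have hD : (0 : ℝ) < (n : ℝ) * k - 1 := by linarith
  -- Here `b` is `(1 - 1/n) / (n k - 1)`, the remaining mass spread evenly.
  refine Lambda_spectra_eq (t := (⟨0, by omega⟩, ⟨0, by omega⟩))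
    (b := ((n : ℝ) - 1) / (n * ((n : ℝ) * k - 1))) (fun ρ hρ => hρ.1) ?_ ?_
  · intro ρ hρ h i
    have key := eigenvalues_le_of_mem_ARED (by omega) le_rfl hnk (by omega) hρ h i
    rw [div_self hD.ne', one_mul] at key
    rw [le_div_iff₀ (by linarith)]
    linarith
  · refine diagonal_spike_mem_ARED (r := n) (by omega) (Or.inl rfl) _ ?_ ?_ ?_ ?_
    · apply div_nonneg
      · linarith
      · positivity
    · rw [div_le_div_iff₀ (by positivity) (by positivity)]
      nlinarith [mul_nonneg (mul_nonneg (show (0 : ℝ) ≤ n by linarith)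
        (show (0 : ℝ) ≤ n by linarith)) (show (0 : ℝ) ≤ k - 1 by linarith)]
    · field_simp; ring
    · field_simp; ring

/-! ### Separable matrices -/

/-- Sums of tensor products of positive semidefinite matrices. -/
def sepCone (n k : ℕ) : AddSubmonoid (BiMat n k) :=
  AddSubmonoid.closure {X | ∃ A : Matrix (Fin n) (Fin n) ℂ, ∃ B : Matrix (Fin k) (Fin k) ℂ,
    A.PosSemidef ∧ B.PosSemidef ∧ X = A ⊗ₖ B}

theorem kronecker_mem_sepCone {n k : ℕ} {A : Matrix (Fin n) (Fin n) ℂ}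
    {B : Matrix (Fin k) (Fin k) ℂ} (hA : A.PosSemidef) (hB : B.PosSemidef) :
    A ⊗ₖ B ∈ sepCone n k :=
  AddSubmonoid.subset_closure ⟨A, B, hA, hB, rfl⟩

theorem smul_mem_sepCone {n k : ℕ} {X : BiMat n k} (hX : X ∈ sepCone n k) {c : ℝ} (hc : 0 ≤ c) :
    c • X ∈ sepCone n k := by
  induction hX using AddSubmonoid.closure_induction with
  | mem X h =>
    obtain ⟨A, B, hA, hB, rfl⟩ := h
    rw [← smul_kronecker]
    exact kronecker_mem_sepCone (hA.smul hc) hB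
  | zero => rw [smul_zero]; exact zero_mem _
  | add X Y _ _ hX hY => rw [smul_add]; exact add_mem hX hY

/-- Product states. -/
def productStates (n k : ℕ) : Set (BiMat n k) :=
  {τ | ∃ A ∈ density (Fin n), ∃ B ∈ density (Fin k), τ = A ⊗ₖ B}

theorem density_nonempty {n : ℕ} (hn : 1 ≤ n) : (density (Fin n)).Nonempty :=
  ⟨_, diagonal_spike_mem_density (⟨0, hn⟩ : Fin n) zero_le_one le_rfl (by simp)⟩

theorem exists_smul_density {ι : Type*} [Fintype ι] {A : Matrix ι ι ℂ} (hA : A.PosSemidef) :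
    A = 0 ∨ ∃ c : ℝ, 0 < c ∧ ∃ B ∈ density ι, A = c • B := by
  classical
  by_cases h0 : A = 0
  · exact Or.inl h0
  right
  have h1 := hA.trace_nonneg
  have h2 : A.trace ≠ 0 := fun h => h0 (hA.trace_eq_zero_iff.1 h)
  obtain ⟨c, hc⟩ : ∃ c : ℝ, A.trace = c :=
    ⟨A.trace.re, Complex.ext rfl (by simpa using (Complex.le_def.1 h1).2.symm)⟩
  rw [hc] at h1 h2
  have hc0 : 0 < c := lt_of_le_of_ne (Complex.zero_le_real.1 h1)
    (fun h => h2 (by rw [← h, Complex.ofReal_zero]))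
  refine ⟨c, hc0, c⁻¹ • A, ⟨hA.smul (inv_nonneg.2 hc0.le), ?_⟩, ?_⟩
  · rw [trace_smul, hc, Complex.real_smul, Complex.ofReal_inv, inv_mul_cancel₀ h2]
  · rw [smul_smul, mul_inv_cancel₀ hc0.ne', one_smul]

theorem trace_eq_one_of_mem_convexHull {n k : ℕ} {X : BiMat n k}
    (hX : X ∈ convexHull ℝ (productStates n k)) : X.trace = 1 := by
  have hconv : Convex ℝ {X : BiMat n k | X.trace = 1} := by
    intro X hX Y hY a b _ _ hab
    simp only [Set.mem_ofPred_eq] at hX hY ⊢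
    rw [trace_add, trace_smul, trace_smul, hX, hY, ← add_smul, hab, one_smul]
  refine convexHull_min ?_ hconv hX
  rintro _ ⟨A, hA, B, hB, rfl⟩
  simp only [Set.mem_ofPred_eq]
  rw [trace_kronecker, hA.2, hB.2, mul_one]

theorem mem_convexHull_of_mem_sepCone {n k : ℕ} (hn : 1 ≤ n) (hk : 1 ≤ k) {X : BiMat n k}
    (hX : X ∈ sepCone n k) (htr : X.trace = 1) : X ∈ convexHull ℝ (productStates n k) := by
  have hne : (convexHull ℝ (productStates n k)).Nonempty := by
    obtain ⟨A, hA⟩ := density_nonempty hn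
    obtain ⟨B, hB⟩ := density_nonempty hk
    exact ⟨_, subset_convexHull _ _ ⟨A, hA, B, hB, rfl⟩⟩
  have hconv := convex_convexHull ℝ (productStates n k)
  -- Summands have arbitrary trace, so the induction runs over nonnegative multiples of the hull;
  -- unit trace forces `c = 1` at the end.
  have key : ∃ c : ℝ, 0 ≤ c ∧ ∃ Y ∈ convexHull ℝ (productStates n k), X = c • Y := by
    clear htr
    induction hX using AddSubmonoid.closure_induction with
    | mem X h =>
      obtain ⟨A, B, hA, hB, rfl⟩ := h
      rcases exists_smul_density hA with rfl | ⟨c, hc, A', hA', rfl⟩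
      · obtain ⟨Y, hY⟩ := hne
        exact ⟨0, le_rfl, Y, hY, by simp⟩
      rcases exists_smul_density hB with rfl | ⟨d, hd, B', hB', rfl⟩
      · obtain ⟨Y, hY⟩ := hne
        exact ⟨0, le_rfl, Y, hY, by simp⟩
      refine ⟨c * d, by positivity, _, subset_convexHull _ _ ⟨A', hA', B', hB', rfl⟩, ?_⟩
      rw [smul_kronecker, kronecker_smul, smul_smul]
    | zero =>
      obtain ⟨Y, hY⟩ := hne
      exact ⟨0, le_rfl, Y, hY, by simp⟩
    | add X Y _ _ hX hY =>
      obtain ⟨c, hc, X', hX', rfl⟩ := hX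
      obtain ⟨d, hd, Y', hY', rfl⟩ := hY
      rcases (add_nonneg hc hd).eq_or_lt with h | h
      · have hc0 : c = 0 := by linarith
        have hd0 : d = 0 := by linarith
        exact ⟨0, le_rfl, X', hX', by simp [hc0, hd0]⟩
      · refine ⟨c + d, h.le, (c / (c + d)) • X' + (d / (c + d)) • Y',
          hconv hX' hY' (by positivity) (by positivity) (by field_simp), ?_⟩
        rw [smul_add, smul_smul, smul_smul, mul_div_cancel₀ _ h.ne', mul_div_cancel₀ _ h.ne']
  obtain ⟨c, -, Y, hY, rfl⟩ := key
  rw [trace_smul, trace_eq_one_of_mem_convexHull hY, Complex.real_smul, mul_one] at htr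
  have : c = 1 := by exact_mod_cast htr
  rwa [this, one_smul]

theorem SEP_subset_PPT {n k : ℕ} : SEP n k ⊆ PPT n k := by
  rintro ρ ⟨hd, hρ⟩
  refine ⟨hd, ?_⟩
  have hconv : Convex ℝ {X : BiMat n k | (idTensor transpose X).PosSemidef} := by
    intro X hX Y hY a b ha hb _
    have h : idTensor transpose (a • X + b • Y) =
        a • idTensor transpose X + b • idTensor transpose Y := rfl
    simp only [Set.mem_ofPred_eq] at hX hY ⊢
    rw [h]
    exact (hX.smul ha).add (hY.smul hb)
  refine convexHull_min ?_ hconv hρ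
  rintro _ ⟨A, hA, B, hB, rfl⟩
  have h : idTensor transpose (A ⊗ₖ B) = A ⊗ₖ Bᵀ := rfl
  simp only [Set.mem_ofPred_eq]
  rw [h]
  exact hA.1.kronecker hB.1.transpose

theorem ASEP_subset_APPT {n k : ℕ} : ASEP n k ⊆ APPT n k :=
  fun _ hρ => ⟨hρ.1, fun U hU => SEP_subset_PPT (hρ.2 U hU)⟩

/-! ### Averages over phases -/

/-- Shifting one coordinate `z j` multiplies the sum by a character value; if `j` has nonzero net
coefficient modulo 3, that value is not `1` and the sum vanishes. Only the pairings `p = q, l = m`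
and `p = l, q = m` survive. -/
theorem sum_stdAddChar_phase {ι : Type*} [Fintype ι] [DecidableEq ι] (p q l m : ι) :
    ∑ z : ι → ZMod 3, (ZMod.stdAddChar (z p - z q - z l + z m) : ℂ) =
      (Fintype.card (ι → ZMod 3) : ℂ) * ((if p = q then if l = m then 1 else 0 else 0) +
        if p = l then if q = m then if p = q then 0 else 1 else 0 else 0) := by
  have hzero : ∀ j, (if p = j then (1 : ZMod 3) else 0) - (if q = j then 1 else 0) -
      (if l = j then 1 else 0) + (if m = j then 1 else 0) ≠ 0 →
      ∑ z : ι → ZMod 3, (ZMod.stdAddChar (z p - z q - z l + z m) : ℂ) = 0 := by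
    intro j hj
    set e : ZMod 3 := (if p = j then (1 : ZMod 3) else 0) - (if q = j then 1 else 0) -
      (if l = j then 1 else 0) + (if m = j then 1 else 0) with he
    have h1 : ∑ z : ι → ZMod 3, (ZMod.stdAddChar (z p - z q - z l + z m) : ℂ) =
        ZMod.stdAddChar e * ∑ z : ι → ZMod 3, (ZMod.stdAddChar (z p - z q - z l + z m) : ℂ) := by
      conv_lhs => rw [← Equiv.sum_comp (Equiv.addRight (Pi.single j (1 : ZMod 3)))]
      rw [Finset.mul_sum]
      refine Finset.sum_congr rfl fun z _ => ?_
      rw [← AddChar.map_add_eq_mul]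
      congr 1
      simp only [Equiv.coe_addRight, Pi.add_apply, Pi.single_apply, he]
      ring
    have h2 : (ZMod.stdAddChar e : ℂ) ≠ 1 := by
      intro h
      rw [← AddChar.map_zero_eq_one (ZMod.stdAddChar (N := 3))] at h
      exact hj (ZMod.injective_stdAddChar h)
    have h3 : (1 - (ZMod.stdAddChar e : ℂ)) *
        ∑ z : ι → ZMod 3, (ZMod.stdAddChar (z p - z q - z l + z m) : ℂ) = 0 := by
      rw [sub_mul, one_mul, ← h1, sub_self]
    exact (mul_eq_zero.1 h3).resolve_left (sub_ne_zero.2 (Ne.symm h2))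
  by_cases hpq : p = q
  · subst hpq
    by_cases hlm : l = m
    · subst hlm
      simp
    · rw [hzero l]
      · simp [hlm]
      · rw [if_pos (rfl : l = l), if_neg (Ne.symm hlm)]
        split_ifs <;> decide
  · by_cases hpl : p = l
    · subst hpl
      by_cases hqm : q = m
      · subst hqm
        simp [hpq]
      · rw [hzero q]
        · simp [hpq, hqm]
        · rw [if_neg hpq, if_pos (rfl : q = q), if_neg (Ne.symm hqm)]
          decide
    · rw [hzero p]
      · simp [hpq, hpl]
      -- The coefficient is `1`, or `2` when `m = p`. The latter is nonzero modulo 3 but not modulo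
      -- 2, so cube roots of unity are used instead of signs.
      · rw [if_pos (rfl : p = p), if_neg (Ne.symm hpq), if_neg (Ne.symm hpl)]
        split_ifs <;> decide

theorem star_stdAddChar (x : ZMod 3) :
    star (ZMod.stdAddChar x : ℂ) = ZMod.stdAddChar (-x) := by
  rw [AddChar.map_neg_eq_conj]; rfl

theorem sum_phase_product {ι : Type*} [Fintype ι] [DecidableEq ι] (f f' g g' : ι → ℂ) :
    ∑ z : ι → ZMod 3,
      ((∑ p, ZMod.stdAddChar (z p) * f p) * star (∑ q, ZMod.stdAddChar (z q) * f' q)) *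
        ((∑ l, ZMod.stdAddChar (-z l) * g l) * star (∑ m, ZMod.stdAddChar (-z m) * g' m)) =
    (Fintype.card (ι → ZMod 3) : ℂ) * (∑ p, ∑ l, f p * star (f' p) * (g l * star (g' l)) +
      ∑ p, ∑ q, if p = q then 0 else f p * star (f' q) * (g p * star (g' q))) := by
  have h1 : ∀ z : ι → ZMod 3,
      ((∑ p, ZMod.stdAddChar (z p) * f p) * star (∑ q, ZMod.stdAddChar (z q) * f' q)) *
        ((∑ l, ZMod.stdAddChar (-z l) * g l) * star (∑ m, ZMod.stdAddChar (-z m) * g' m)) =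
      ∑ p, ∑ q, ∑ l, ∑ m, (ZMod.stdAddChar (z p - z q - z l + z m) : ℂ) *
        (f p * star (f' q) * (g l * star (g' m))) := by
    intro z
    simp only [star_sum, star_mul, star_stdAddChar, neg_neg, Finset.sum_mul_sum]
    refine Finset.sum_congr rfl fun p _ => ?_
    rw [Finset.sum_comm]
    refine Finset.sum_congr rfl fun q _ => ?_
    refine Finset.sum_congr rfl fun l _ => Finset.sum_congr rfl fun m _ => ?_
    have : z p - z q - z l + z m = z p + -z q + -z l + z m := by ring
    rw [this, AddChar.map_add_eq_mul, AddChar.map_add_eq_mul, AddChar.map_add_eq_mul]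
    ring
  simp only [h1]
  rw [Finset.sum_comm]
  rw [Finset.sum_congr rfl fun p _ => Finset.sum_comm]
  rw [Finset.sum_congr rfl fun p _ => Finset.sum_congr rfl fun q _ => Finset.sum_comm]
  rw [Finset.sum_congr rfl fun p _ => Finset.sum_congr rfl fun q _ =>
    Finset.sum_congr rfl fun l _ => Finset.sum_comm]
  simp only [← Finset.sum_mul, sum_stdAddChar_phase, mul_assoc, ← Finset.mul_sum]
  congr 1
  simp only [add_mul, Finset.sum_add_distrib, ite_mul, one_mul, zero_mul]
  congr 1
  · simp [Finset.mul_sum]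
  · refine Finset.sum_congr rfl fun p _ => Finset.sum_congr rfl fun q _ => ?_
    simp

/-! ### Schmidt decomposition -/

/-- Diagonalising `Aᴴ * A` for the reshaped vector `A` gives orthogonal columns, normalised to `E`.
There are `k` of them even when the rank is smaller, so `E` is only a partial isometry; positivity
of `1 - E * Eᴴ` is what is used later. -/
theorem exists_schmidt {n k : ℕ} {u : Fin n × Fin k → ℂ} (hu : ∑ x, ‖u x‖ ^ 2 = 1) :
    ∃ (s : Fin k → ℝ) (E : Matrix (Fin n) (Fin k) ℂ) (F : Matrix (Fin k) (Fin k) ℂ),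
      (∀ l, 0 ≤ s l) ∧ ∑ l, s l ^ 2 = 1 ∧ (1 - E * Eᴴ).PosSemidef ∧ Fᴴ * F = 1 ∧
      ∀ i a, u (i, a) = ∑ l, s l * E i l * F l a := by
  set A : Matrix (Fin n) (Fin k) ℂ := of fun i a => u (i, a) with hA
  have hG : (Aᴴ * A).PosSemidef := posSemidef_conjTranspose_mul_self A
  have hH := hG.isHermitian
  obtain ⟨U, hU, hUe⟩ := exists_unitary_conj_eq hH (one_mem (unitaryGroup (Fin k) ℂ)) 1
  rw [one_mul, star_one, mul_one] at hUe
  simp only [Equiv.Perm.coe_one, id] at hUe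
  have hD0 := hG.eigenvalues_nonneg
  have hDtr := hH.trace_eq_sum_eigenvalues
  change ∀ i, 0 ≤ hH.eigenvalues i at hD0
  generalize hH.eigenvalues = D at *
  have hUU := mem_unitaryGroup_iff'.1 hU
  rw [star_eq_conjTranspose] at hUU hUe
  set B := A * Uᴴ with hB
  have hBB : Bᴴ * B = diagonal fun i => (D i : ℂ) := by
    rw [← hUe, hB, conjTranspose_mul, conjTranspose_conjTranspose]
    simp only [Matrix.mul_assoc]
  have hBU : B * U = A := by rw [hB, Matrix.mul_assoc, hUU, Matrix.mul_one]
  set s : Fin k → ℝ := fun l => √(D l) with hs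
  have hss : ∀ l, s l * s l = D l := fun l => Real.mul_self_sqrt (hD0 l)
  -- Where `s l = 0` the inverse is `0`, so that column of `E` vanishes, as does the column of `B`.
  set E : Matrix (Fin n) (Fin k) ℂ := B * diagonal (fun l => (((s l)⁻¹ : ℝ) : ℂ)) with hE
  have hsE : ∀ i l, (s l : ℂ) * E i l = B i l := by
    intro i l
    rw [hE, mul_diagonal]
    by_cases h : s l = 0
    · have h1 := congrFun (congrFun hBB l) l
      rw [diagonal_apply_eq, ← hss, h, mul_apply] at h1
      simp only [conjTranspose_apply, Complex.star_def, Complex.conj_mul'] at h1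
      have h2 : ∑ i, ‖B i l‖ ^ 2 = 0 := by
        have : ((∑ i, ‖B i l‖ ^ 2 : ℝ) : ℂ) = ((0 : ℝ) : ℂ) := by push_cast; simpa using h1
        exact_mod_cast this
      have h3 := (Finset.sum_eq_zero_iff_of_nonneg fun i _ => sq_nonneg ‖B i l‖).1 h2 i
        (Finset.mem_univ i)
      have h4 : B i l = 0 := by simpa using h3
      simp [h4]
    · have h' : (s l : ℂ) ≠ 0 := by exact_mod_cast h
      push_cast
      field_simp
  have hEE : E * (Eᴴ * E) = E := by
    have h1 : Eᴴ * E = diagonal (fun l => (((s l)⁻¹ * (s l * s l) * (s l)⁻¹ : ℝ) : ℂ)) := by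
      rw [hE, conjTranspose_mul, diagonal_conjTranspose, Matrix.mul_assoc, ← Matrix.mul_assoc Bᴴ,
        hBB, diagonal_mul_diagonal, diagonal_mul_diagonal]
      congr 1
      ext l
      simp only [Pi.star_apply, Complex.star_def, Complex.conj_ofReal, ← hss l]
      push_cast
      ring
    rw [h1, hE, Matrix.mul_assoc, diagonal_mul_diagonal]
    congr 2
    ext l
    rw [← Complex.ofReal_mul]
    congr 1
    by_cases h : s l = 0
    · simp [h]
    · field_simp
  refine ⟨s, E, U, fun l => Real.sqrt_nonneg _, ?_, ?_, hUU, ?_⟩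
  · have h1 : (Aᴴ * A).trace = ((∑ x, ‖u x‖ ^ 2 : ℝ) : ℂ) := by
      rw [Fintype.sum_prod_type, Finset.sum_comm]
      simp [trace, mul_apply, hA, Complex.conj_mul']
    rw [hu] at h1
    rw [h1] at hDtr
    have h2 : (1 : ℝ) = ∑ i, D i := by simpa using congrArg Complex.re hDtr
    rw [h2]
    exact Finset.sum_congr rfl fun l _ => by rw [sq, hss]
  · have h1 : 1 - E * Eᴴ = (1 - E * Eᴴ) * (1 - E * Eᴴ)ᴴ := by
      have h2 : (E * Eᴴ) * (E * Eᴴ) = E * Eᴴ := by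
        rw [← Matrix.mul_assoc, Matrix.mul_assoc E, hEE]
      have h3 : (E * Eᴴ)ᴴ = E * Eᴴ := isHermitian_mul_conjTranspose_self E
      rw [conjTranspose_sub, conjTranspose_one, h3, sub_mul, mul_sub, mul_sub, h2]
      simp
    rw [h1]
    exact posSemidef_self_mul_conjTranspose _
  · intro i a
    simp only [hsE]
    rw [← mul_apply, hBU]
    rfl

/-! ### The random robustness of a pure state -/

/-- The phase average of `x x* ⊗ y y*` is `u u*` plus the terms `s_p s_l e_p e_p* ⊗ f_l f_l*` with
`p ≠ l`. Twice that error is subtracted from the identity; the rest splits as `∑ T_l ⊗ f_l f_l*`,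
with `T_l ≥ 0` because `2 s_p s_l ≤ s_p² + s_l² ≤ 1`. -/
theorem one_add_two_smul_mem_sepCone {n k : ℕ} {u : Fin n × Fin k → ℂ}
    (hu : ∑ x, ‖u x‖ ^ 2 = 1) :
    (1 + (2 : ℝ) • vecMulVec u (star u) : BiMat n k) ∈ sepCone n k := by
  obtain ⟨s, E, F, hs0, hs1, hE, hF, hus⟩ := exists_schmidt hu
  set N : ℝ := (Fintype.card (Fin k → ZMod 3) : ℝ) with hN
  have hN0 : 0 < N := by rw [hN]; exact_mod_cast Fintype.card_pos
  have hss : ∀ p l, p ≠ l → 2 * (s p * s l) ≤ 1 := by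
    intro p l hpl
    have h1 : ∑ j ∈ {p, l}, s j ^ 2 ≤ ∑ j, s j ^ 2 :=
      Finset.sum_le_sum_of_subset_of_nonneg (Finset.subset_univ _) fun j _ _ => sq_nonneg _
    rw [Finset.sum_pair hpl, hs1] at h1
    nlinarith [sq_nonneg (s p - s l)]
  set x : (Fin k → ZMod 3) → Fin n → ℂ := fun z i =>
    ∑ p, ZMod.stdAddChar (z p) * ((√(s p) : ℝ) * E i p) with hx
  set y : (Fin k → ZMod 3) → Fin k → ℂ := fun z a =>
    ∑ p, ZMod.stdAddChar (-z p) * ((√(s p) : ℝ) * F p a) with hy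
  -- This is `1 - 2 ∑_{p ≠ l} s_p s_l e_p e_p*`, split along `E * Eᴴ` and its complement so that
  -- positivity is visible.
  set T : Fin k → Matrix (Fin n) (Fin n) ℂ := fun l =>
    (1 - E * Eᴴ) + E * diagonal (fun p => ((1 - if p = l then 0 else 2 * (s p * s l) : ℝ) : ℂ)) * Eᴴ
    with hT
  have hTpsd : ∀ l, (T l).PosSemidef := by
    intro l
    refine hE.add (PosSemidef.mul_mul_conjTranspose_same (PosSemidef.diagonal fun p => ?_) E)
    simp only [Pi.zero_apply, Complex.zero_le_real, sub_nonneg]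
    split_ifs with h
    · exact zero_le_one
    · exact hss p l h
  have key : (1 + (2 : ℝ) • vecMulVec u (star u) : BiMat n k) =
      ∑ z, (2 / N : ℝ) • (vecMulVec (x z) (star (x z)) ⊗ₖ vecMulVec (y z) (star (y z))) +
      ∑ l, T l ⊗ₖ vecMulVec (F l) (star (F l)) := by
    ext ⟨i, a⟩ ⟨i', a'⟩
    have hphase := sum_phase_product (fun p => (√(s p) : ℝ) * E i p)
      (fun p => (√(s p) : ℝ) * E i' p) (fun p => (√(s p) : ℝ) * F p a)
      (fun p => (√(s p) : ℝ) * F p a')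
    have hsq : ∀ p, ((√(s p) : ℝ) : ℂ) * ((√(s p) : ℝ) : ℂ) = s p := by
      intro p
      rw [← Complex.ofReal_mul, Real.mul_self_sqrt (hs0 p)]
    have hT_apply : ∀ l, T l i i' = (if i = i' then 1 else 0) -
        ∑ p, if p = l then 0 else 2 * (s p * s l) * (E i p * star (E i' p)) := by
      intro l
      have h1 : (E * Eᴴ) i i' = ∑ p, E i p * star (E i' p) := by simp [mul_apply]
      have h2 : (E * diagonal (fun p => ((1 - if p = l then 0 else 2 * (s p * s l) : ℝ) : ℂ)) * Eᴴ)
          i i' = ∑ p, E i p * star (E i' p) -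
          ∑ p, if p = l then 0 else 2 * (s p * s l) * (E i p * star (E i' p)) := by
        rw [mul_apply, ← Finset.sum_sub_distrib]
        refine Finset.sum_congr rfl fun p _ => ?_
        rw [mul_diagonal, conjTranspose_apply]
        split_ifs <;> (push_cast; ring)
      rw [hT]
      simp only [Matrix.add_apply, Matrix.sub_apply, h1, h2, one_apply]
      ring
    have hFF : ∑ l, F l a * star (F l a') = if a = a' then 1 else 0 := by
      have := congrFun (congrFun hF a') a
      rw [mul_apply, one_apply] at this
      simp only [conjTranspose_apply] at this
      simp only [eq_comm (a := a), ← this, mul_comm]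
    have hR : ∑ l, T l i i' * (F l a * star (F l a')) =
        (if i = i' then if a = a' then 1 else 0 else 0) -
        ∑ p, ∑ l, if p = l then 0 else
          2 * (s p * s l) * (E i p * star (E i' p)) * (F l a * star (F l a')) := by
      simp only [hT_apply, sub_mul, Finset.sum_sub_distrib, ← Finset.mul_sum, hFF]
      congr 1
      · split_ifs <;> simp
      · rw [Finset.sum_comm]
        refine Finset.sum_congr rfl fun l _ => ?_
        rw [Finset.sum_mul]
        exact Finset.sum_congr rfl fun p _ => by split_ifs <;> simp
    have hL : ∑ z, ((x z i * star (x z i')) * (y z a * star (y z a'))) =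
        (N : ℂ) * (u (i, a) * star (u (i', a')) + ∑ p, ∑ l, if p = l then 0 else
          s p * s l * (E i p * star (E i' p)) * (F l a * star (F l a'))) := by
      simp only [hx, hy]
      rw [hphase, hN]
      push_cast
      congr 1
      simp only [hus, star_sum, Finset.sum_mul_sum, ← Finset.sum_add_distrib]
      refine Finset.sum_congr rfl fun p _ => Finset.sum_congr rfl fun q _ => ?_
      simp only [star_mul, Complex.star_def, Complex.conj_ofReal]
      by_cases hpq : p = q
      · subst hpq
        simp only [if_true, ← hsq p]
        ring
      · simp only [if_neg hpq, ← hsq p, ← hsq q]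
        ring
    simp only [Matrix.add_apply, Matrix.sum_apply, Matrix.smul_apply, kroneckerMap_apply,
      vecMulVec_apply, Pi.star_apply, hR, Complex.real_smul, one_apply, Prod.mk.injEq]
    have hc : ((2 / N : ℝ) : ℂ) * (N : ℂ) = ((2 : ℝ) : ℂ) := by
      rw [← Complex.ofReal_mul, div_mul_cancel₀ _ hN0.ne']
    rw [← Finset.mul_sum, hL, ← mul_assoc ((2 / N : ℝ) : ℂ), hc, mul_add, Finset.mul_sum]
    have h3 : ∀ p, ((2 : ℝ) : ℂ) * ∑ l, (if p = l then 0 else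
          s p * s l * (E i p * star (E i' p)) * (F l a * star (F l a'))) =
        ∑ l, if p = l then 0 else
          2 * (s p * s l) * (E i p * star (E i' p)) * (F l a * star (F l a')) := by
      intro p
      rw [Finset.mul_sum]
      refine Finset.sum_congr rfl fun l _ => ?_
      split_ifs
      · simp
      · push_cast; ring
    simp only [h3]
    rw [← ite_and]
    ring
  rw [key]
  refine add_mem (sum_mem fun z _ => ?_) (sum_mem fun l _ => ?_)
  · exact smul_mem_sepCone (kronecker_mem_sepCone (posSemidef_vecMulVec_self_star _)
      (posSemidef_vecMulVec_self_star _)) (by positivity)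
  · exact kronecker_mem_sepCone (hTpsd l) (posSemidef_vecMulVec_self_star _)

theorem diagonal_spike_mem_ASEP {n k : ℕ} (t : Fin n × Fin k) :
    (diagonal fun i => (spike t (3 / ((n : ℝ) * k + 2)) (1 / ((n : ℝ) * k + 2)) i : ℂ)) ∈
      ASEP n k := by
  have hn : 1 ≤ n := by have := t.1.2; omega
  have hk : 1 ≤ k := by have := t.2.2; omega
  have hd := diagonal_spike_mem_density t (a := 3 / ((n : ℝ) * k + 2))
    (b := 1 / ((n : ℝ) * k + 2)) (by positivity) (by positivity)
    (by simp only [Fintype.card_prod, Fintype.card_fin]; push_cast; field_simp; ring)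
  refine ⟨hd, fun U hU => ?_⟩
  have hdU := mul_conj_unitary_mem_density hd hU
  refine ⟨hdU, mem_convexHull_of_mem_sepCone hn hk ?_ hdU.2⟩
  obtain ⟨u, hu, he⟩ := exists_conj_diagonal_spike t (3 / ((n : ℝ) * k + 2))
    (1 / ((n : ℝ) * k + 2)) hU
  have h1 : U * diagonal (fun i => (spike t (3 / ((n : ℝ) * k + 2))
      (1 / ((n : ℝ) * k + 2)) i : ℂ)) * star U =
      (1 / ((n : ℝ) * k + 2)) • (1 + (2 : ℝ) • vecMulVec u (star u) : BiMat n k) := by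
    rw [he]
    ext x y
    simp only [Matrix.add_apply, Matrix.smul_apply, smul_eq_mul, Complex.real_smul]
    push_cast
    ring
  rw [h1]
  exact smul_mem_sepCone (one_add_two_smul_mem_sepCone hu) (by positivity)

/-- The upper bound holds on all of `APPT` and the extremal spectrum already lies in `ASEP`. -/
theorem Lambda_eq_of_ASEP_subset {n k : ℕ} (hn : 2 ≤ n) (hk : 2 ≤ k) {S : Set (BiMat n k)}
    (h1 : ASEP n k ⊆ S) (h2 : S ⊆ APPT n k) :
    Lambda (spectra S) = 3 / ((n : ℝ) * k + 2) :=
  Lambda_spectra_eq (fun _ hρ => (h2 hρ).1)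
    (fun _ hρ h i => eigenvalues_le_of_mem_APPT hn hk (h2 hρ) h i)
    (h1 (diagonal_spike_mem_ASEP (⟨0, by omega⟩, ⟨0, by omega⟩)))

end AbsSpec

theorem mainTheorem8 (n k : ℕ) (hn : 2 ≤ n) (hk : 2 ≤ k) :
    (k ≤ n → AbsSpec.Lambda (AbsSpec.spectra (AbsSpec.ARED n k)) =
      ((k : ℝ) + 1) / ((k : ℝ) * ((n : ℝ) + 1))) ∧
    (n ≤ k → AbsSpec.Lambda (AbsSpec.spectra (AbsSpec.ARED n k)) = 1 / (n : ℝ)) ∧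
    (∀ p : ℕ, 1 ≤ p → p < n * k →
      AbsSpec.Lambda (AbsSpec.LS (n * k) p) = (p : ℝ) / ((n : ℝ) * (k : ℝ) + (p : ℝ) - 1)) ∧
    AbsSpec.Lambda (AbsSpec.LS (n * k) (n * k)) = 1 ∧
    AbsSpec.Lambda (AbsSpec.spectra (AbsSpec.ASEP n k)) = 3 / ((n : ℝ) * (k : ℝ) + 2) ∧
    AbsSpec.Lambda (AbsSpec.spectra (AbsSpec.APPT n k)) = 3 / ((n : ℝ) * (k : ℝ) + 2) ∧
    AbsSpec.Lambda (AbsSpec.GER n k) = 3 / ((n : ℝ) * (k : ℝ) + 2) ∧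
    AbsSpec.Lambda (AbsSpec.spectra (AbsSpec.SEPBALL n k)) = 2 / ((n : ℝ) * (k : ℝ)) := by
  refine ⟨fun h => AbsSpec.Lambda_ARED_of_le hk h, fun h => AbsSpec.Lambda_ARED_of_ge hn h,
    fun p hp hpd => ?_, AbsSpec.Lambda_LS_self (Nat.mul_pos (by omega) (by omega)),
    AbsSpec.Lambda_eq_of_ASEP_subset hn hk subset_rfl AbsSpec.ASEP_subset_APPT,
    AbsSpec.Lambda_eq_of_ASEP_subset hn hk AbsSpec.ASEP_subset_APPT subset_rfl,
    AbsSpec.Lambda_GER hn hk, AbsSpec.Lambda_SEPBALL hn hk⟩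
  simpa using AbsSpec.Lambda_LS hp hpd
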